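/- **Setting.** Let $x_L<x_R$, let $\sigma_T$ be measurable on $[x_L,x_R]$ with $0<a\le\sigma_T\le b<\infty$, let $q\in L^2(x_L,x_R)$ and $0<\delta<1$. Put $S=[-1,-\delta)\cup(\delta,1]$, and let $\psi_L$ be Lipschitz on $(\delta,1]$ and $\psi_R$ be Lipschitz on $[-1,-\delta)$. For a measurable $\sigma_S\ge 0$ put $\lambda=\|\sigma_S/\sigma_T\|_{L^\infty(x_L,x_R)}$. Write $\|f\|=\big(\int_{x_L}^{x_R}f^2\sigma_T\,dx\big)^{1/2}$ for the norm of $L^2(\sigma_T)$. Solutions of the equations below are absolutely continuous in $x$ on $[x_L,x_R]$ and satisfy them for a.e. $x$. *Truncated transport equation.* $\psi(x,\mu)$, $\mu\in S$, is integrable in $\mu$ over $S$ for each $x$ and solves $$\mu\,\partial_x\psi+\sigma_T\psi=\sigma_S\,\phi+q,\qquad \phi(x)=\frac1{|S|}\int_S\psi(x,\mu)\,d\mu,$$ $$\psi(x_L,\mu)=\psi_L(\mu)\ (\mu>0),\qquad \psi(x_R,\mu)=\psi_R(\mu)\ (\mu<0).$$ *Random ordinate method (ROM).* Let $n=2m$,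 let $S_1,\dots,S_m$ be consecutive intervals $[t_{\ell-1},t_\ell)$ partitioning $[-1,-\delta)$, with $-1=t_0<\dots<t_m=-\delta$, and let $S_{m+\ell}=-S_{m+1-\ell}$ for $1\le\ell\le m$. The weights are $\omega_\ell=|S_\ell|/|S|$ and the rescaled weights are $\alpha_\ell=n\omega_\ell$. The ordinates $\mu_1,\dots,\mu_m$ are independent, $\mu_\ell$ uniformly distributed on $S_\ell$, and $\mu_{m+\ell}=-\mu_{m+1-\ell}$. For (almost) every realization $\xi$, $(\psi_\ell)_{\ell=1}^n$ solves $$\mu_\ell\,\psi_\ell'+\sigma_T\psi_\ell=\sigma_S\,\phi^\xi+q,\qquad \phi^\xi=\sum_{\ell=1}^n\omega_\ell\psi_\ell,$$ $$\psi_\ell(x_L)=\psi_L(\mu_\ell)\ (\mu_\ell>0),\qquad \psi_\ell(x_R)=\psi_R(\mu_\ell)\ (\mu_\ell<0).$$ **Theorem.** Let $x_L,x_R,\sigma_T,q,\delta,\psi_L,\psi_R$ be as above, let $A\in\mathbb R$ and $\lambda_0<1$. There are constants $C$ and $n_0>0$, depending only on these data, such that for every $\sigma_S$ as above with $0<\lambda\le\lambda_0$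 the truncated transport equation has a solution and, for each solution, its average density $\phi$ lies in $L^2(\sigma_T)$. Moreover, for every even $n>n_0$ and every partition as above with $\alpha_\ell\le A$ for all $\ell$, the ROM system almost surely has a solution and, for every family of solutions indexed by the realizations, the following holds. Almost surely $\phi^\xi\in L^2(\sigma_T)$; for each $x\in[x_L,x_R]$ the random variable $\phi^\xi(x)$ is integrable; the function $\mathbb E\phi^\xi$ lies in $L^2(\sigma_T)$; and $\|\phi^\xi-\phi\|$ is a random variable (measurable up to null sets). The expected single-run error satisfies $$\mathbb E\|\phi^\xi-\phi\|\le C\,n^{-3/2}(\log n)^{1/2},$$ and the bias satisfies $$\|\mathbb E\phi^\xi-\phi\|\le C\,\lambda\,n^{-3}\log n.$$ -/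

import Mathlib

open MeasureTheory ProbabilityTheory
open scoped ENNReal NNReal

noncomputable section

namespace SlabROM

/-- The truncated velocity space `[-1, -δ) ∪ (δ, 1]`. -/
def velocitySpace (δ : ℝ) : Set ℝ := Set.Ico (-1) (-δ) ∪ Set.Ioc δ 1

/-- `ψ` solves `μ ψ' + σT ψ = source` on `[xL, xR]` (absolutely continuous, equation almost
everywhere), and has the value `inflow` at the end through which velocity `μ` enters. -/
def SolvesTransport (xL xR : ℝ) (σT source : ℝ → ℝ) (μ inflow : ℝ) (ψ : ℝ → ℝ) : Prop :=
  AbsolutelyContinuousOnInterval ψ xL xR ∧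
  (∀ᵐ x ∂volume.restrict (Set.Icc xL xR), μ * deriv ψ x + σT x * ψ x = source x) ∧
  (0 < μ → ψ xL = inflow) ∧ (μ < 0 → ψ xR = inflow)

/-- The inflow boundary data: `ψL` at the left end for `μ > 0`, `ψR` at the right end for
`μ < 0`. -/
def inflowData (ψL ψR : ℝ → ℝ) (μ : ℝ) : ℝ := if 0 < μ then ψL μ else ψR μ

/-- The average density `φ(x)`: the mean of `ψ(x, ·)` over the truncated velocity space. -/
def avgDensity (δ : ℝ) (ψ : ℝ → ℝ → ℝ) (x : ℝ) : ℝ := ⨍ μ in velocitySpace δ, ψ x μ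

/-- `ψ` (as `ψ x μ`) solves the truncated radiative transport equation with isotropic scattering,
`μ ∂ₓψ + σT ψ = σS φ + q` for every `μ` in the truncated velocity space, with inflow data
`ψL`, `ψR`, where `φ` is the average density of `ψ`. -/
def SolvesRTE (xL xR : ℝ) (σT σS q ψL ψR : ℝ → ℝ) (δ : ℝ) (ψ : ℝ → ℝ → ℝ) : Prop :=
  (∀ x ∈ Set.Icc xL xR, IntegrableOn (ψ x) (velocitySpace δ)) ∧
  ∀ μ ∈ velocitySpace δ,
    SolvesTransport xL xR σT (fun x => σS x * avgDensity δ ψ x + q x) μ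
      (inflowData ψL ψR μ) (fun x => ψ x μ)

/-- `t` lists the endpoints of a partition of `[-1, -δ)` into `m` intervals. -/
def IsPartition {m : ℕ} (δ : ℝ) (t : Fin (m + 1) → ℝ) : Prop :=
  StrictMono t ∧ t 0 = -1 ∧ t (Fin.last m) = -δ

/-- The `m` cells of `[-1, -δ)`, in increasing order. -/
def halfCell {m : ℕ} (t : Fin (m + 1) → ℝ) (l : Fin m) : Set ℝ :=
  Set.Ico (t l.castSucc) (t l.succ)

/-- All `n = m + m` cells: those of `[-1, -δ)`, then their mirror images in `(δ, 1]`. -/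
def cell {m : ℕ} (t : Fin (m + 1) → ℝ) : Fin (m + m) → Set ℝ :=
  Fin.append (halfCell t) (fun l => {v : ℝ | -v ∈ halfCell t l.rev})

/-- The weight of a cell: its length divided by the length of the truncated velocity space. -/
def weight {m : ℕ} (δ : ℝ) (t : Fin (m + 1) → ℝ) (l : Fin (m + m)) : ℝ :=
  volume.real (cell t l) / volume.real (velocitySpace δ)

/-- The rescaled weight: `n` times the weight, with `n = m + m` the number of cells. -/
def rescaledWeight {m : ℕ} (δ : ℝ) (t : Fin (m + 1) → ℝ) (l : Fin (m + m)) : ℝ :=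
  ((m + m : ℕ) : ℝ) * weight δ t l

/-- The symmetric ordinates: the given `m` negative ones, then their reflections in reverse
order, i.e. (counting from `1`) the ordinate `m + l` is minus the ordinate `m + 1 - l`. -/
def symOrdinate {m : ℕ} (u : Fin m → ℝ) : Fin (m + m) → ℝ :=
  Fin.append u (fun l => -u l.rev)

/-- The discrete average density: the weighted sum of the discrete solutions. -/
def discreteDensity {m : ℕ} (δ : ℝ) (t : Fin (m + 1) → ℝ) (ψ : Fin (m + m) → ℝ → ℝ)
    (x : ℝ) : ℝ := ∑ l, weight δ t l * ψ l x

/-- `ψ` solves the discrete ordinate system with the symmetric ordinates generated by `u`. -/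
def SolvesROM {m : ℕ} (xL xR : ℝ) (σT σS q ψL ψR : ℝ → ℝ) (δ : ℝ) (t : Fin (m + 1) → ℝ)
    (u : Fin m → ℝ) (ψ : Fin (m + m) → ℝ → ℝ) : Prop :=
  ∀ l, SolvesTransport xL xR σT (fun x => σS x * discreteDensity δ t ψ x + q x)
    (symOrdinate u l) (inflowData ψL ψR (symOrdinate u l)) (ψ l)

/-- The measure `σT dx` on `[xL, xR]`; the norm of `L²(σT)` is `eLpNorm · 2` for it. -/
def weightedMeasure (xL xR : ℝ) (σT : ℝ → ℝ) : Measure ℝ :=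
  (volume.restrict (Set.Icc xL xR)).withDensity (fun x => ENNReal.ofReal (σT x))

end SlabROM

end

/-!
The error analysis rests on the integral form of the transport equation. In terms of the measure
`ν = σT dx` on the slab, Duhamel's formula (`duhamel`, `solvesTransport_duhamel`) writes the
solution with velocity `μ` and source `σT f` as an attenuated boundary value plus
`∫ G μ x y f y ∂ν`, with a Green kernel `G` that is nonnegative, bounded and Lipschitz in `μ` on each half of the
truncated velocity space. Its row sums are at most one because the constant `1` solves the
equation with source `σT` (`integral_G_le_one`), and so are its column sums, by the reciprocity
`G (-μ) y x = G μ x y`.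

Averaging over the velocity, uniformly for the continuous problem and over the weighted ordinates
for the discrete one, turns both problems into `φ = b + ∫ K (c φ) ∂ν` with `c = σS / σT ≤ lam < 1`
and a kernel `K` whose row and column sums are at most one. A Neumann series gives existence,
measurably in the ordinates (`exists_measurable_solution`), and the contraction in the supremum
norm gives uniqueness (`abs_le_of_abs_defect_le`). Hence the densities of arbitrary families of
solutions can be replaced by a canonical, jointly measurable one.

The error `e` of the random density solves `e = ∫ Kξ (c e) ∂ν + r` (`error_eq`), where `r` is the
error of stratified sampling applied to the exact solution. It is unbiased, and its variance is
`O(n⁻³)`, as each of the independent pairs of ordinates has weight `O(n⁻¹)` and is spread over a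
cell of length `O(n⁻¹)` (`integral_ordinateSum`, `integral_sq_ordinateSum_sub_le`). Schur's test
gives the stability of the equation in `L²(ν)` for each realization (`integral_sq_le_of_eq_add`),
and therefore a mean square error `O(n⁻³)` (`integral_integral_error_sq_le`), which is the
single-run estimate.

For the bias, taking expectations in the equation leaves
`E e = ∫ K (c E e) ∂ν + E ∫ (Kξ - K) (c e) ∂ν`. The kernel `Kξ - K` is itself an error of stratified sampling, of mean square `O(n⁻³)` at
each pair of points, so the last term is `O(lam n⁻³)`, and stability in the supremum norm
concludes (`abs_integral_error_le`). The logarithms of the claim are not needed, since the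
truncation `δ > 0` makes all integrands Lipschitz in the velocity; for `n > 3` they are at least
one.
-/

noncomputable section

/-! ### Absolutely continuous functions -/

/-- A function that is Lipschitz on the range of an absolutely continuous function preserves
absolute continuity. -/
theorem AbsolutelyContinuousOnInterval.lipschitzOnWith_comp {f g : ℝ → ℝ} {a b : ℝ} {K : ℝ≥0}
    {s : Set ℝ} (hf : AbsolutelyContinuousOnInterval f a b)
    (hfs : Set.MapsTo f (Set.uIcc a b) s) (hg : LipschitzOnWith K g s) :
    AbsolutelyContinuousOnInterval (fun x => g (f x)) a b := by
  rw [absolutelyContinuousOnInterval_iff] at hf ⊢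
  intro ε hε
  obtain ⟨d, hd, h⟩ := hf (ε / (K + 1)) (by positivity)
  refine ⟨d, hd, fun E hE hl => ?_⟩
  have h1 := h E hE hl
  have hmem := hE.1
  calc ∑ i ∈ Finset.range E.1, dist (g (f (E.2 i).1)) (g (f (E.2 i).2))
      ≤ ∑ i ∈ Finset.range E.1, K * dist (f (E.2 i).1) (f (E.2 i).2) := by
        refine Finset.sum_le_sum fun i hi => ?_
        exact hg.dist_le_mul _ (hfs (hmem i hi).1) _ (hfs (hmem i hi).2)
    _ = K * ∑ i ∈ Finset.range E.1, dist (f (E.2 i).1) (f (E.2 i).2) := by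
        rw [Finset.mul_sum]
    _ ≤ (K + 1) * ∑ i ∈ Finset.range E.1, dist (f (E.2 i).1) (f (E.2 i).2) := by
        refine mul_le_mul_of_nonneg_right (by linarith) (Finset.sum_nonneg fun _ _ => dist_nonneg)
    _ < (K + 1) * (ε / (K + 1)) := by
        exact mul_lt_mul_of_pos_left h1 (by positivity)
    _ = ε := by field_simp

namespace SlabROM

/-! ### The slab, its optical depth, and the transport equation in integral form -/

/-- The geometry of the problem: the slab `[xL, xR]`, its total cross section `σT`, bounded between
positive constants, and the truncation parameter `δ` of the velocity space. -/
structure Slab where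
  /-- The left end of the slab. -/
  xL : ℝ
  /-- The right end of the slab. -/
  xR : ℝ
  lt : xL < xR
  /-- The total cross section. -/
  σT : ℝ → ℝ
  meas : Measurable σT
  /-- A positive lower bound of the total cross section. -/
  lo : ℝ
  /-- An upper bound of the total cross section. -/
  hi : ℝ
  lo_pos : 0 < lo
  bounds : ∀ x ∈ Set.Icc xL xR, lo ≤ σT x ∧ σT x ≤ hi
  /-- The truncation parameter. -/
  δ : ℝ
  δ_pos : 0 < δ
  δ_lt : δ < 1

namespace Slab

variable (M : Slab)

/-- The interval occupied by the slab. -/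
def I : Set ℝ := Set.Icc M.xL M.xR

/-- The measure `σT dx` on the slab. -/
def ν : Measure ℝ := weightedMeasure M.xL M.xR M.σT

/-- The truncated velocity space. -/
def S : Set ℝ := velocitySpace M.δ

/-- The optical depth `∫ σT` measured from the left end. The cross section is cut off outside the
slab, so that the depth is a continuous function on the whole line. -/
def τ (x : ℝ) : ℝ := ∫ y in M.xL..x, M.I.indicator M.σT y

/-- The end of the slab through which particles of velocity `μ` enter. -/
def inflowEnd (μ : ℝ) : ℝ := if 0 < μ then M.xL else M.xR

lemma measurableSet_I : MeasurableSet M.I := measurableSet_Icc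

lemma measurableSet_S : MeasurableSet M.S := measurableSet_Ico.union measurableSet_Ioc

lemma uIcc_eq : Set.uIcc M.xL M.xR = M.I := Set.uIcc_of_le M.lt.le

lemma xL_mem : M.xL ∈ M.I := ⟨le_rfl, M.lt.le⟩

lemma xR_mem : M.xR ∈ M.I := ⟨M.lt.le, le_rfl⟩

lemma inflowEnd_mem (μ : ℝ) : M.inflowEnd μ ∈ M.I := by
  unfold inflowEnd
  split_ifs
  exacts [M.xL_mem, M.xR_mem]

lemma σT_pos {x : ℝ} (hx : x ∈ M.I) : 0 < M.σT x := M.lo_pos.trans_le (M.bounds x hx).1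

lemma ae_mem_I : ∀ᵐ x ∂(volume.restrict M.I), x ∈ M.I := ae_restrict_mem M.measurableSet_I

lemma integrableOn_σT : IntegrableOn M.σT M.I := by
  refine Measure.integrableOn_of_bounded (M := M.hi) (by simp [I])
    M.meas.aestronglyMeasurable ?_
  filter_upwards [M.ae_mem_I] with x hx
  rw [Real.norm_of_nonneg (M.σT_pos hx).le]
  exact (M.bounds x hx).2

lemma intervalIntegrable_indicator (a b : ℝ) :
    IntervalIntegrable (M.I.indicator M.σT) volume a b :=
  (M.integrableOn_σT.integrable_indicator M.measurableSet_I).intervalIntegrable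

lemma continuous_τ : Continuous M.τ :=
  intervalIntegral.continuous_primitive M.intervalIntegrable_indicator _

lemma τ_sub (x y : ℝ) : M.τ y - M.τ x = ∫ z in x..y, M.I.indicator M.σT z :=
  intervalIntegral.integral_interval_sub_left (M.intervalIntegrable_indicator _ _)
    (M.intervalIntegrable_indicator _ _)

lemma monotone_τ : Monotone M.τ := by
  intro x y hxy
  rw [← sub_nonneg, τ_sub]
  refine intervalIntegral.integral_nonneg hxy fun z _ => ?_
  exact Set.indicator_nonneg (fun w hw => (M.σT_pos hw).le) z

lemma ac_τ : AbsolutelyContinuousOnInterval M.τ M.xL M.xR :=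
  (M.intervalIntegrable_indicator _ _).absolutelyContinuousOnInterval_intervalIntegral
    Set.left_mem_uIcc

lemma ae_hasDerivAt_τ : ∀ᵐ x, x ∈ M.I → HasDerivAt M.τ (M.σT x) x := by
  filter_upwards [(M.intervalIntegrable_indicator M.xL M.xR).ae_hasDerivAt_integral] with x hx hxI
  have h := hx (by rwa [uIcc_eq]) M.xL Set.left_mem_uIcc
  rwa [Set.indicator_of_mem hxI] at h

lemma ac_exp_τ (k : ℝ) :
    AbsolutelyContinuousOnInterval (fun x => Real.exp (k * M.τ x)) M.xL M.xR := by
  have hc : ContDiff ℝ 1 (fun t : ℝ => Real.exp (k * t)) := by fun_prop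
  obtain ⟨K, hK⟩ := (hc.contDiffOn (s := Set.Icc (M.τ M.xL) (M.τ M.xR))).exists_lipschitzOnWith
    one_ne_zero (convex_Icc _ _) isCompact_Icc
  refine M.ac_τ.lipschitzOnWith_comp (g := fun t : ℝ => Real.exp (k * t)) (fun x hx => ?_) hK
  rw [uIcc_eq] at hx
  exact ⟨M.monotone_τ hx.1, M.monotone_τ hx.2⟩

lemma ae_restrict_iff_I {p : ℝ → Prop} :
    (∀ᵐ x ∂(volume.restrict M.I), p x) ↔ ∀ᵐ x, x ∈ M.I → p x :=
  ae_restrict_iff' M.measurableSet_I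

lemma intervalIntegrable_of_integrableOn {f : ℝ → ℝ} (hf : IntegrableOn f M.I) {x y : ℝ}
    (hx : x ∈ M.I) (hy : y ∈ M.I) : IntervalIntegrable f volume x y := by
  rw [intervalIntegrable_iff]
  exact hf.mono_set (Set.uIoc_subset_uIcc.trans (Set.ordConnected_Icc.uIcc_subset hx hy))

lemma continuous_exp_τ (k : ℝ) : Continuous fun x => Real.exp (k * M.τ x) := by
  have := M.continuous_τ
  fun_prop

lemma exp_mul_integrableOn {f : ℝ → ℝ} (hf : IntegrableOn f M.I) (k : ℝ) :
    IntegrableOn (fun x => Real.exp (k * M.τ x) * f x) M.I :=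
  hf.continuousOn_mul (M.continuous_exp_τ k).continuousOn isCompact_Icc

/-- The source of a transport equation that has an absolutely continuous solution is
integrable. -/
lemma integrableOn_source {s ψ : ℝ → ℝ} {μ g : ℝ}
    (h : SolvesTransport M.xL M.xR M.σT s μ g ψ) : IntegrableOn s M.I := by
  have h1 : IntegrableOn (deriv ψ) M.I := by
    have := h.1.intervalIntegrable_deriv
    rwa [intervalIntegrable_iff_integrableOn_Icc_of_le M.lt.le] at this
  have h2 : IntegrableOn (fun x => M.σT x * ψ x) M.I := by
    have hc := h.1.continuousOn
    rw [uIcc_eq] at hc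
    exact M.integrableOn_σT.mul_continuousOn hc isCompact_Icc
  exact ((h1.const_mul μ).add h2).congr h.2.1

/-- Duhamel's formula: the solution of the transport equation is determined by its inflow value and
its source. -/
lemma duhamel {s ψ : ℝ → ℝ} {μ g : ℝ} (hμ : μ ≠ 0)
    (h : SolvesTransport M.xL M.xR M.σT s μ g ψ) {x : ℝ} (hx : x ∈ M.I) :
    ψ x = g * Real.exp (-((M.τ x - M.τ (M.inflowEnd μ)) / μ)) +
      ∫ y in (M.inflowEnd μ)..x, μ⁻¹ * Real.exp (-((M.τ x - M.τ y) / μ)) * s y := by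
  set x₀ := M.inflowEnd μ with hx₀
  have hx₀I : x₀ ∈ M.I := M.inflowEnd_mem μ
  have hg : ψ x₀ = g := by
    rw [hx₀, inflowEnd]
    split_ifs with hp
    · exact h.2.2.1 hp
    · exact h.2.2.2 (lt_of_le_of_ne (not_lt.mp hp) hμ)
  have hsub : Set.uIcc x₀ x ⊆ Set.uIcc M.xL M.xR := by
    rw [uIcc_eq]
    exact Set.ordConnected_Icc.uIcc_subset hx₀I hx
  have hac := ((M.ac_exp_τ μ⁻¹).fun_mul h.1)
  have hd : ∀ᵐ y, y ∈ M.I → deriv (fun z => Real.exp (μ⁻¹ * M.τ z) * ψ z) y =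
      Real.exp (μ⁻¹ * M.τ y) * (μ⁻¹ * s y) := by
    filter_upwards [M.ae_hasDerivAt_τ, h.1.ae_differentiableAt, M.ae_restrict_iff_I.mp h.2.1]
      with y h1 h2 h3 hy
    have h4 := (h2 (by rwa [uIcc_eq])).hasDerivAt
    have h5 := ((h1 hy).const_mul μ⁻¹).exp
    rw [(h5.fun_mul h4).deriv, ← h3 hy]
    field_simp
    ring
  have hF := (hac.mono hsub).integral_deriv_eq_sub
  rw [intervalIntegral.integral_congr_ae (g := fun y => Real.exp (μ⁻¹ * M.τ y) * (μ⁻¹ * s y))] at hF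
  swap
  · filter_upwards [hd] with y hy hy2
    refine hy ?_
    rw [← uIcc_eq]
    exact hsub (Set.uIoc_subset_uIcc hy2)
  have hI : ∫ y in x₀..x, μ⁻¹ * Real.exp (-((M.τ x - M.τ y) / μ)) * s y =
      Real.exp (-(μ⁻¹ * M.τ x)) * ∫ y in x₀..x, Real.exp (μ⁻¹ * M.τ y) * (μ⁻¹ * s y) := by
    rw [← intervalIntegral.integral_const_mul]
    congr 1
    ext y
    rw [show -((M.τ x - M.τ y) / μ) = -(μ⁻¹ * M.τ x) + μ⁻¹ * M.τ y by field_simp; ring,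
      Real.exp_add]
    ring
  rw [hI, hF, hg, show -((M.τ x - M.τ x₀) / μ) = -(μ⁻¹ * M.τ x) + μ⁻¹ * M.τ x₀ by field_simp; ring,
    Real.exp_add]
  have : Real.exp (-(μ⁻¹ * M.τ x)) * Real.exp (μ⁻¹ * M.τ x) = 1 := by
    rw [← Real.exp_add]; simp
  linear_combination (-ψ x) * this

/-- Duhamel's formula produces a solution of the transport equation, for every integrable source
and every inflow value. -/
lemma solvesTransport_duhamel {s ψ : ℝ → ℝ} {μ g : ℝ} (hμ : μ ≠ 0) (hs : IntegrableOn s M.I)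
    (hψ : ∀ x ∈ M.I, ψ x = g * Real.exp (-((M.τ x - M.τ (M.inflowEnd μ)) / μ)) +
      ∫ y in (M.inflowEnd μ)..x, μ⁻¹ * Real.exp (-((M.τ x - M.τ y) / μ)) * s y) :
    SolvesTransport M.xL M.xR M.σT s μ g ψ := by
  set x₀ := M.inflowEnd μ with hx₀
  have hx₀I : x₀ ∈ M.I := M.inflowEnd_mem μ
  set W : ℝ → ℝ := fun x => ∫ y in x₀..x, Real.exp (μ⁻¹ * M.τ y) * (μ⁻¹ * s y) with hW
  set Ψ : ℝ → ℝ := fun x => Real.exp (-μ⁻¹ * M.τ x) * (g * Real.exp (μ⁻¹ * M.τ x₀) + W x) with hΨ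
  have heq : ∀ x ∈ M.I, ψ x = Ψ x := by
    intro x hx
    rw [hψ x hx, hΨ, hW]
    simp only
    rw [mul_add, ← intervalIntegral.integral_const_mul,
      show -((M.τ x - M.τ x₀) / μ) = -μ⁻¹ * M.τ x + μ⁻¹ * M.τ x₀ by field_simp; ring, Real.exp_add]
    congr 1
    · ring
    · congr 1
      ext y
      rw [show -((M.τ x - M.τ y) / μ) = -μ⁻¹ * M.τ x + μ⁻¹ * M.τ y by field_simp; ring,
        Real.exp_add]
      ring
  have hint : IntervalIntegrable (fun y => Real.exp (μ⁻¹ * M.τ y) * (μ⁻¹ * s y)) volume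
      M.xL M.xR :=
    M.intervalIntegrable_of_integrableOn (M.exp_mul_integrableOn (hs.const_mul μ⁻¹) μ⁻¹)
      M.xL_mem M.xR_mem
  have hWac : AbsolutelyContinuousOnInterval W M.xL M.xR :=
    hint.absolutelyContinuousOnInterval_intervalIntegral (by rwa [uIcc_eq])
  have hconst : AbsolutelyContinuousOnInterval (fun _ : ℝ => g * Real.exp (μ⁻¹ * M.τ x₀))
      M.xL M.xR := by
    have : LipschitzOnWith 0 (fun _ : ℝ => g * Real.exp (μ⁻¹ * M.τ x₀)) (Set.uIcc M.xL M.xR) :=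
      (LipschitzWith.const _).lipschitzOnWith
    exact this.absolutelyContinuousOnInterval
  have hΨac : AbsolutelyContinuousOnInterval Ψ M.xL M.xR :=
    (M.ac_exp_τ (-μ⁻¹)).fun_mul (hconst.fun_add hWac)
  have hac : AbsolutelyContinuousOnInterval ψ M.xL M.xR := by
    rw [absolutelyContinuousOnInterval_iff] at hΨac ⊢
    intro ε hε
    obtain ⟨d, hd, h⟩ := hΨac ε hε
    refine ⟨d, hd, fun E hE hl => ?_⟩
    convert h E hE hl using 1
    refine Finset.sum_congr rfl fun i hi => ?_
    have := hE.1 i hi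
    rw [uIcc_eq] at this
    rw [heq _ this.1, heq _ this.2]
  have hψ₀ : ψ x₀ = g := by
    rw [hψ x₀ hx₀I]
    simp
  refine ⟨hac, ?_, fun hp => ?_, fun hn => ?_⟩
  · change ∀ᵐ x ∂(volume.restrict M.I), _
    rw [M.ae_restrict_iff_I]
    -- almost every point of the slab is an interior point, where `ψ` agrees with `Ψ` nearby
    have hend : ∀ᵐ x : ℝ, x ≠ M.xL ∧ x ≠ M.xR := by
      have h1 : ∀ᵐ x : ℝ, x ≠ M.xL := by simp [ae_iff]
      have h2 : ∀ᵐ x : ℝ, x ≠ M.xR := by simp [ae_iff]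
      filter_upwards [h1, h2] with x a b using ⟨a, b⟩
    filter_upwards [M.ae_hasDerivAt_τ, hint.ae_hasDerivAt_integral, hend] with x h1 h2 h3 hx
    have hW' := h2 (by rwa [uIcc_eq]) x₀ (by rwa [uIcc_eq])
    have hE' := ((h1 hx).const_mul (-μ⁻¹)).exp
    have hΨ' := hE'.mul (hW'.const_add (g * Real.exp (μ⁻¹ * M.τ x₀)))
    have hev : ψ =ᶠ[nhds x] Ψ := by
      have : Set.Ioo M.xL M.xR ∈ nhds x :=
        Ioo_mem_nhds (lt_of_le_of_ne hx.1 (Ne.symm h3.1)) (lt_of_le_of_ne hx.2 h3.2)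
      filter_upwards [this] with y hy
      exact heq y ⟨hy.1.le, hy.2.le⟩
    have hd := (hΨ'.congr_of_eventuallyEq hev).deriv
    rw [hd, heq x hx, hΨ]
    have he : Real.exp (-μ⁻¹ * M.τ x) * Real.exp (μ⁻¹ * M.τ x) = 1 := by
      rw [← Real.exp_add]; simp
    have hμ' : μ * μ⁻¹ = 1 := mul_inv_cancel₀ hμ
    simp only [hW]
    linear_combination (μ * μ⁻¹ * s x) * he + (s x - Real.exp (-μ⁻¹ * M.τ x) * M.σT x *
      (g * Real.exp (μ⁻¹ * M.τ x₀) + ∫ y in x₀..x, Real.exp (μ⁻¹ * M.τ y) * (μ⁻¹ * s y))) * hμ'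
  · rw [hx₀, inflowEnd, if_pos hp] at hψ₀
    exact hψ₀
  · rw [hx₀, inflowEnd, if_neg (not_lt.mpr hn.le)] at hψ₀
    exact hψ₀

/-! ### The Green kernel of the transport equation -/

lemma mem_S_iff {μ : ℝ} : μ ∈ M.S ↔ M.δ < |μ| ∧ |μ| ≤ 1 := by
  have := M.δ_pos
  simp only [S, velocitySpace, Set.mem_union, Set.mem_Ico, Set.mem_Ioc]
  constructor
  · rintro (h | h)
    · rw [abs_of_neg (by linarith)]
      exact ⟨by linarith, by linarith⟩
    · rw [abs_of_pos (by linarith)]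
      exact h
  · rintro ⟨h1, h2⟩
    rcases lt_abs.mp h1 with h | h
    · exact Or.inr ⟨h, (le_abs_self _).trans h2⟩
    · exact Or.inl ⟨by linarith [neg_abs_le μ], by linarith⟩

lemma neg_mem_S_iff {μ : ℝ} : -μ ∈ M.S ↔ μ ∈ M.S := by
  rw [mem_S_iff, mem_S_iff, abs_neg]

lemma abs_pos_of_mem_S {μ : ℝ} (h : μ ∈ M.S) : 0 < |μ| := M.δ_pos.trans (M.mem_S_iff.mp h).1

lemma ne_zero_of_mem_S {μ : ℝ} (h : μ ∈ M.S) : μ ≠ 0 := abs_pos.mp (M.abs_pos_of_mem_S h)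

lemma inv_abs_le {μ : ℝ} (h : μ ∈ M.S) : |μ|⁻¹ ≤ M.δ⁻¹ :=
  inv_anti₀ M.δ_pos (M.mem_S_iff.mp h).1.le

open Classical in
/-- The Green kernel: `G μ x y` is the density at `x`, for the velocity `μ`, caused by a unit source
at `y` measured against `σT dx`. It is set to zero unless both points lie in the slab and `μ` in the
truncated velocity space; the last condition says that `y` is upstream of `x`. -/
def G (μ x y : ℝ) : ℝ :=
  if x ∈ M.I ∧ y ∈ M.I ∧ μ ∈ M.S ∧ 0 < μ * (x - y) then
    |μ|⁻¹ * Real.exp (-((M.τ x - M.τ y) / μ)) else 0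

open Classical in
/-- The factor by which the boundary value is attenuated on its way to `x` along the
velocity `μ`. -/
def att (μ x : ℝ) : ℝ :=
  if x ∈ M.I ∧ μ ∈ M.S then Real.exp (-((M.τ x - M.τ (M.inflowEnd μ)) / μ)) else 0

/-- Reciprocity of the Green kernel. -/
lemma G_symm (μ x y : ℝ) : M.G (-μ) y x = M.G μ x y := by
  unfold G
  rw [M.neg_mem_S_iff, abs_neg]
  rw [show -μ * (y - x) = μ * (x - y) by ring,
    show (M.τ y - M.τ x) / -μ = (M.τ x - M.τ y) / μ by rw [div_neg, ← neg_div, neg_sub]]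
  classical exact if_congr (by tauto) rfl rfl

lemma upstream_depth {μ x y : ℝ} (h : 0 < μ * (x - y)) :
    (M.τ x - M.τ y) / μ = |M.τ x - M.τ y| * |μ|⁻¹ := by
  rcases pos_and_pos_or_neg_and_neg_of_mul_pos h with ⟨h1, h2⟩ | ⟨h1, h2⟩
  · rw [abs_of_pos h1, abs_of_nonneg (sub_nonneg.mpr (M.monotone_τ (by linarith)))]
    rfl
  · rw [abs_of_neg h1, abs_of_nonpos (sub_nonpos.mpr (M.monotone_τ (by linarith)))]
    field_simp

lemma upstream_depth_inflowEnd {μ x : ℝ} (hμ : μ ≠ 0) (hx : x ∈ M.I) :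
    (M.τ x - M.τ (M.inflowEnd μ)) / μ = |M.τ x - M.τ (M.inflowEnd μ)| * |μ|⁻¹ := by
  unfold inflowEnd
  split_ifs with h
  · rw [abs_of_pos h, abs_of_nonneg (sub_nonneg.mpr (M.monotone_τ hx.1))]
    rfl
  · have h' : μ < 0 := lt_of_le_of_ne (not_lt.mp h) hμ
    rw [abs_of_neg h', abs_of_nonpos (sub_nonpos.mpr (M.monotone_τ hx.2))]
    field_simp

/-- The total optical depth of the slab. -/
def depth : ℝ := M.τ M.xR - M.τ M.xL

lemma depth_nonneg : 0 ≤ M.depth := sub_nonneg.mpr (M.monotone_τ M.lt.le)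

lemma abs_τ_sub_le {x y : ℝ} (hx : x ∈ M.I) (hy : y ∈ M.I) : |M.τ x - M.τ y| ≤ M.depth := by
  have h1 := M.monotone_τ hx.1
  have h2 := M.monotone_τ hx.2
  have h3 := M.monotone_τ hy.1
  have h4 := M.monotone_τ hy.2
  unfold depth
  rw [abs_le]
  constructor <;> linarith

lemma G_nonneg (μ x y : ℝ) : 0 ≤ M.G μ x y := by
  unfold G
  split_ifs <;> positivity

lemma G_le (μ x y : ℝ) : M.G μ x y ≤ M.δ⁻¹ := by
  have := M.δ_pos
  unfold G
  split_ifs with h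
  · rw [M.upstream_depth h.2.2.2]
    calc |μ|⁻¹ * Real.exp (-(|M.τ x - M.τ y| * |μ|⁻¹)) ≤ |μ|⁻¹ * 1 := by
          gcongr
          rw [Real.exp_le_one_iff]
          have : 0 ≤ |M.τ x - M.τ y| * |μ|⁻¹ := by positivity
          linarith
      _ ≤ M.δ⁻¹ := by rw [mul_one]; exact M.inv_abs_le h.2.2.1
  · positivity

lemma abs_G_le (μ x y : ℝ) : |M.G μ x y| ≤ M.δ⁻¹ := by
  rw [abs_of_nonneg (M.G_nonneg _ _ _)]
  exact M.G_le _ _ _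

lemma att_nonneg (μ x : ℝ) : 0 ≤ M.att μ x := by
  unfold att
  split_ifs <;> positivity

lemma att_le_one (μ x : ℝ) : M.att μ x ≤ 1 := by
  unfold att
  split_ifs with h
  · rw [M.upstream_depth_inflowEnd (M.ne_zero_of_mem_S h.2) h.1, Real.exp_le_one_iff]
    have : 0 ≤ |M.τ x - M.τ (M.inflowEnd μ)| * |μ|⁻¹ := by positivity
    linarith
  · norm_num

lemma att_eq_zero_of_notMem {μ x : ℝ} (hx : x ∉ M.I) : M.att μ x = 0 := by simp [att, hx]

lemma measurable_G : Measurable fun p : ℝ × ℝ × ℝ => M.G p.1 p.2.1 p.2.2 := by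
  have hτ := M.continuous_τ.measurable
  unfold G
  refine Measurable.ite ?_ ?_ measurable_const
  swap
  · exact measurable_fst.abs.inv.mul (Real.measurable_exp.comp
      ((((hτ.comp measurable_snd.fst).sub (hτ.comp measurable_snd.snd)).div measurable_fst).neg))
  refine MeasurableSet.inter (measurable_snd.fst M.measurableSet_I)
    (MeasurableSet.inter (measurable_snd.snd M.measurableSet_I)
      (MeasurableSet.inter (measurable_fst M.measurableSet_S) ?_))
  have : Measurable fun p : ℝ × ℝ × ℝ => p.1 * (p.2.1 - p.2.2) := by fun_prop
  exact this measurableSet_Ioi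

lemma measurable_G_comp {α : Type*} [MeasurableSpace α] {f g h : α → ℝ} (hf : Measurable f)
    (hg : Measurable g) (hh : Measurable h) : Measurable fun a => M.G (f a) (g a) (h a) :=
  M.measurable_G.comp (hf.prodMk (hg.prodMk hh))

lemma measurable_inflowEnd : Measurable M.inflowEnd :=
  Measurable.ite measurableSet_Ioi measurable_const measurable_const

lemma measurable_att : Measurable fun p : ℝ × ℝ => M.att p.1 p.2 := by
  have hτ := M.continuous_τ.measurable
  have := M.measurable_inflowEnd
  unfold att
  refine Measurable.ite ?_ ?_ measurable_const
  swap
  · exact Real.measurable_exp.comp ((((hτ.comp measurable_snd).sub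
      (hτ.comp (this.comp measurable_fst))).div measurable_fst).neg)
  exact MeasurableSet.inter (measurable_snd M.measurableSet_I) (measurable_fst M.measurableSet_S)

lemma _root_.abs_exp_neg_sub_exp_neg_le {a b : ℝ} (ha : 0 ≤ a) (hb : 0 ≤ b) :
    |Real.exp (-a) - Real.exp (-b)| ≤ |a - b| := by
  wlog hab : a ≤ b generalizing a b
  · rw [abs_sub_comm, abs_sub_comm a b]
    exact this hb ha (le_of_not_ge hab)
  rw [abs_of_nonneg (sub_nonneg.mpr (Real.exp_le_exp.mpr (by linarith))), abs_sub_comm,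
    abs_of_nonneg (by linarith)]
  have h1 : Real.exp (-b) = Real.exp (-a) * Real.exp (-(b - a)) := by
    rw [← Real.exp_add]; ring_nf
  have h2 : Real.exp (-a) ≤ 1 := Real.exp_le_one_iff.mpr (by linarith)
  have h3 := Real.add_one_le_exp (-(b - a))
  have h4 := Real.exp_pos (-a)
  rw [h1]
  nlinarith

lemma abs_inv_sub_inv_le {μ μ' : ℝ} (h : μ ∈ M.S) (h' : μ' ∈ M.S) :
    |(|μ|⁻¹ - |μ'|⁻¹)| ≤ (M.δ⁻¹) ^ 2 * |μ - μ'| := by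
  have p := M.abs_pos_of_mem_S h
  have p' := M.abs_pos_of_mem_S h'
  rw [inv_sub_inv p.ne' p'.ne', abs_div, abs_mul, abs_abs, abs_abs, div_eq_inv_mul, mul_inv,
    pow_two]
  have h1 : |(|μ'| - |μ|)| ≤ |μ - μ'| := by
    rw [abs_sub_comm]
    exact abs_abs_sub_abs_le_abs_sub _ _
  have := M.δ_pos
  exact mul_le_mul (mul_le_mul (M.inv_abs_le h) (M.inv_abs_le h') (by positivity) (by positivity))
    h1 (abs_nonneg _) (by positivity)

/-- A Lipschitz constant of the Green kernel in the velocity, on each half of the truncated velocity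
space. -/
def lipG : ℝ := (1 + M.δ⁻¹ * M.depth) * (M.δ⁻¹) ^ 2

lemma lipG_nonneg : 0 ≤ M.lipG := by
  have := M.δ_pos
  have := M.depth_nonneg
  unfold lipG
  positivity

lemma abs_G_sub_le {μ μ' : ℝ} (h : μ ∈ M.S) (h' : μ' ∈ M.S) (hs : 0 < μ * μ') (x y : ℝ) :
    |M.G μ x y - M.G μ' x y| ≤ M.lipG * |μ - μ'| := by
  have hiff : 0 < μ * (x - y) ↔ 0 < μ' * (x - y) := by
    rcases pos_and_pos_or_neg_and_neg_of_mul_pos hs with ⟨h1, h2⟩ | ⟨h1, h2⟩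
    · rw [mul_pos_iff_of_pos_left h1, mul_pos_iff_of_pos_left h2]
    · constructor <;> intro h3 <;> nlinarith [pos_and_pos_or_neg_and_neg_of_mul_pos h3]
  have hL := M.lipG_nonneg
  by_cases hc : x ∈ M.I ∧ y ∈ M.I ∧ 0 < μ * (x - y)
  · have hc' : 0 < μ' * (x - y) := hiff.mp hc.2.2
    unfold G
    rw [if_pos ⟨hc.1, hc.2.1, h, hc.2.2⟩, if_pos ⟨hc.1, hc.2.1, h', hc'⟩,
      M.upstream_depth hc.2.2, M.upstream_depth hc']
    set t := |M.τ x - M.τ y|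
    have ht : t ≤ M.depth := M.abs_τ_sub_le hc.1 hc.2.1
    have ht0 : 0 ≤ t := abs_nonneg _
    have hi := M.abs_inv_sub_inv_le h h'
    set p := |μ|⁻¹
    set p' := |μ'|⁻¹
    have hp : 0 ≤ p := by positivity
    have hp' : 0 ≤ p' := by positivity
    have hp1 : p' ≤ M.δ⁻¹ := M.inv_abs_le h'
    have he := abs_exp_neg_sub_exp_neg_le (mul_nonneg ht0 hp) (mul_nonneg ht0 hp')
    rw [← mul_sub, abs_mul, abs_of_nonneg ht0] at he
    have he1 : |Real.exp (-(t * p))| ≤ 1 := by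
      rw [abs_of_pos (Real.exp_pos _), Real.exp_le_one_iff]
      have := mul_nonneg ht0 hp
      linarith
    have hδ : 0 ≤ M.δ⁻¹ := inv_nonneg.mpr M.δ_pos.le
    calc |p * Real.exp (-(t * p)) - p' * Real.exp (-(t * p'))|
        = |(p - p') * Real.exp (-(t * p)) + p' * (Real.exp (-(t * p)) - Real.exp (-(t * p')))| := by
          ring_nf
      _ ≤ |p - p'| * 1 + M.δ⁻¹ * (M.depth * |p - p'|) := by
          refine (abs_add_le _ _).trans ?_
          rw [abs_mul, abs_mul, abs_of_nonneg hp']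
          gcongr
          exact he.trans (by gcongr)
      _ = (1 + M.δ⁻¹ * M.depth) * |p - p'| := by ring
      _ ≤ (1 + M.δ⁻¹ * M.depth) * ((M.δ⁻¹) ^ 2 * |μ - μ'|) := by
          have := M.depth_nonneg
          gcongr
      _ = M.lipG * |μ - μ'| := by unfold lipG; ring
  · have h1 : M.G μ x y = 0 := if_neg (by tauto)
    have h2 : M.G μ' x y = 0 := if_neg (by tauto)
    rw [h1, h2, sub_zero, abs_zero]
    positivity

lemma abs_att_sub_le {μ μ' : ℝ} (h : μ ∈ M.S) (h' : μ' ∈ M.S) (hs : 0 < μ * μ') (x : ℝ) :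
    |M.att μ x - M.att μ' x| ≤ M.depth * (M.δ⁻¹) ^ 2 * |μ - μ'| := by
  have hd := M.depth_nonneg
  by_cases hx : x ∈ M.I
  · have he : M.inflowEnd μ = M.inflowEnd μ' := by
      unfold inflowEnd
      rcases pos_and_pos_or_neg_and_neg_of_mul_pos hs with ⟨h1, h2⟩ | ⟨h1, h2⟩
      · rw [if_pos h1, if_pos h2]
      · rw [if_neg h1.not_gt, if_neg h2.not_gt]
    unfold att
    rw [if_pos ⟨hx, h⟩, if_pos ⟨hx, h'⟩, M.upstream_depth_inflowEnd (M.ne_zero_of_mem_S h) hx,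
      M.upstream_depth_inflowEnd (M.ne_zero_of_mem_S h') hx, ← he]
    set t := |M.τ x - M.τ (M.inflowEnd μ)|
    have ht : t ≤ M.depth := M.abs_τ_sub_le hx (M.inflowEnd_mem μ)
    have ht0 : 0 ≤ t := abs_nonneg _
    refine (abs_exp_neg_sub_exp_neg_le (by positivity) (by positivity)).trans ?_
    rw [← mul_sub, abs_mul, abs_of_nonneg ht0, mul_assoc]
    gcongr
    exact M.abs_inv_sub_inv_le h h'
  · rw [M.att_eq_zero_of_notMem hx, M.att_eq_zero_of_notMem hx, sub_zero, abs_zero]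
    positivity

/-! ### Integrals against `σT dx` -/

lemma measurable_density : Measurable fun x => ENNReal.ofReal (M.σT x) := M.meas.ennreal_ofReal

lemma integral_ν (f : ℝ → ℝ) : ∫ x, f x ∂M.ν = ∫ x in M.I, M.σT x * f x := by
  unfold ν weightedMeasure
  rw [integral_withDensity_eq_integral_toReal_smul M.measurable_density (by simp)]
  refine setIntegral_congr_fun M.measurableSet_I fun x hx => ?_
  simp only [smul_eq_mul]
  rw [ENNReal.toReal_ofReal (M.σT_pos hx).le]

lemma integrable_ν_iff (f : ℝ → ℝ) :
    Integrable f M.ν ↔ IntegrableOn (fun x => M.σT x * f x) M.I := by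
  unfold ν weightedMeasure
  rw [integrable_withDensity_iff_integrable_smul' M.measurable_density (by simp)]
  refine integrable_congr ?_
  filter_upwards [ae_restrict_mem measurableSet_Icc] with x hx
  rw [ENNReal.toReal_ofReal (M.σT_pos hx).le, smul_eq_mul]

instance : IsFiniteMeasure M.ν := by
  refine isFiniteMeasure_withDensity_ofReal ?_
  exact M.integrableOn_σT.2

lemma ν_absolutelyContinuous : M.ν ≪ volume.restrict M.I := withDensity_absolutelyContinuous _ _

lemma ae_ν_mem : ∀ᵐ x ∂M.ν, x ∈ M.I := M.ν_absolutelyContinuous.ae_le M.ae_mem_I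

lemma integrable_G_mul {f : ℝ → ℝ} (hf : Integrable f M.ν) (μ x : ℝ) :
    Integrable (fun y => M.G μ x y * f y) M.ν := by
  refine hf.bdd_mul (c := M.δ⁻¹) ?_ (Filter.Eventually.of_forall fun y => M.abs_G_le μ x y)
  exact (M.measurable_G_comp measurable_const measurable_const measurable_id).aestronglyMeasurable

lemma integral_duhamel_eq {f : ℝ → ℝ} {μ x : ℝ} (hμ : μ ∈ M.S) (hx : x ∈ M.I) :
    ∫ y in (M.inflowEnd μ)..x, μ⁻¹ * Real.exp (-((M.τ x - M.τ y) / μ)) * (M.σT y * f y) =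
      ∫ y, M.G μ x y * f y ∂M.ν := by
  rw [integral_ν]
  rcases lt_or_gt_of_ne (M.ne_zero_of_mem_S hμ) with h | h
  · rw [inflowEnd, if_neg h.not_gt, intervalIntegral.integral_symm,
      intervalIntegral.integral_of_le hx.2, ← integral_neg]
    have hset : M.I ∩ Set.Ioi x = Set.Ioc x M.xR := by
      ext y
      simp only [I, Set.mem_inter_iff, Set.mem_Icc, Set.mem_Ioi, Set.mem_Ioc]
      exact ⟨fun h => ⟨h.2, h.1.2⟩, fun h => ⟨⟨hx.1.trans h.1.le, h.2⟩, h.1⟩⟩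
    rw [← hset, ← setIntegral_indicator measurableSet_Ioi]
    refine setIntegral_congr_fun M.measurableSet_I fun y hy => ?_
    by_cases hyx : x < y
    · rw [Set.indicator_of_mem (by exact hyx)]
      simp only [G]
      rw [if_pos ⟨hx, hy, hμ, mul_pos_of_neg_of_neg h (by linarith)⟩, abs_of_neg h, inv_neg]
      ring
    · rw [Set.indicator_of_notMem (by exact hyx)]
      simp only [G]
      rw [if_neg (fun hc => not_lt.mpr
        (mul_nonpos_of_nonpos_of_nonneg h.le (by linarith)) hc.2.2.2)]
      ring
  · rw [inflowEnd, if_pos h, intervalIntegral.integral_of_le hx.1, ← integral_Icc_eq_integral_Ioc,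
      integral_Icc_eq_integral_Ico]
    have hset : M.I ∩ Set.Iio x = Set.Ico M.xL x := by
      ext y
      simp only [I, Set.mem_inter_iff, Set.mem_Icc, Set.mem_Iio, Set.mem_Ico]
      exact ⟨fun h => ⟨h.1.1, h.2⟩, fun h => ⟨⟨h.1, h.2.le.trans hx.2⟩, h.2⟩⟩
    rw [← hset, ← setIntegral_indicator measurableSet_Iio]
    refine setIntegral_congr_fun M.measurableSet_I fun y hy => ?_
    by_cases hyx : y < x
    · rw [Set.indicator_of_mem (by exact hyx)]
      simp only [G]
      rw [if_pos ⟨hx, hy, hμ, mul_pos h (by linarith)⟩, abs_of_pos h]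
      ring
    · rw [Set.indicator_of_notMem (by exact hyx)]
      simp only [G]
      rw [if_neg (fun hc => not_lt.mpr
        (mul_nonpos_of_nonneg_of_nonpos h.le (by linarith)) hc.2.2.2)]
      ring

/-- The transport equation in integral form, with the Green kernel. -/
lemma eq_att_add_integral {s f ψ : ℝ → ℝ} {μ g : ℝ} (hμ : μ ∈ M.S)
    (h : SolvesTransport M.xL M.xR M.σT s μ g ψ) (hsf : ∀ x ∈ M.I, s x = M.σT x * f x)
    {x : ℝ} (hx : x ∈ M.I) :
    ψ x = g * M.att μ x + ∫ y, M.G μ x y * f y ∂M.ν := by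
  rw [M.duhamel (M.ne_zero_of_mem_S hμ) h hx, ← M.integral_duhamel_eq hμ hx, att, if_pos ⟨hx, hμ⟩]
  congr 1
  refine intervalIntegral.integral_congr fun y hy => ?_
  rw [hsf y (Set.ordConnected_Icc.uIcc_subset (M.inflowEnd_mem μ) hx hy)]

/-- The integral form of the transport equation produces a solution. -/
lemma solvesTransport_of_eq {s f ψ : ℝ → ℝ} {μ g : ℝ} (hμ : μ ∈ M.S) (hf : Integrable f M.ν)
    (hsf : ∀ x ∈ M.I, s x = M.σT x * f x)
    (hψ : ∀ x ∈ M.I, ψ x = g * M.att μ x + ∫ y, M.G μ x y * f y ∂M.ν) :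
    SolvesTransport M.xL M.xR M.σT s μ g ψ := by
  refine M.solvesTransport_duhamel (M.ne_zero_of_mem_S hμ) ?_ fun x hx => ?_
  · exact ((M.integrable_ν_iff f).mp hf).congr_fun (fun x hx => (hsf x hx).symm) M.measurableSet_I
  · rw [hψ x hx, ← M.integral_duhamel_eq hμ hx, att, if_pos ⟨hx, hμ⟩]
    congr 1
    refine intervalIntegral.integral_congr fun y hy => ?_
    rw [hsf y (Set.ordConnected_Icc.uIcc_subset (M.inflowEnd_mem μ) hx hy)]

/-- The Green kernel has row sums at most one: Duhamel's formula for the constant solution `1`, with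
source `σT` and inflow value `1`, says that the row sum and the attenuation add up to one. -/
lemma integral_G_le_one (μ x : ℝ) : ∫ y, M.G μ x y ∂M.ν ≤ 1 := by
  by_cases h : x ∈ M.I ∧ μ ∈ M.S
  · have h1 : SolvesTransport M.xL M.xR M.σT M.σT μ 1 (fun _ => 1) := by
      have hl : LipschitzOnWith 0 (fun _ : ℝ => (1 : ℝ)) (Set.uIcc M.xL M.xR) :=
        (LipschitzWith.const _).lipschitzOnWith
      exact ⟨hl.absolutelyContinuousOnInterval, by simp, by simp, by simp⟩
    have h2 := M.eq_att_add_integral (f := fun _ => 1) h.2 h1 (by simp) h.1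
    have h3 := M.att_nonneg μ x
    simp only [mul_one, one_mul] at h2
    linarith
  · have : ∀ y, M.G μ x y = 0 := fun y => if_neg (by tauto)
    simp [this]

/-- By reciprocity the column sums of the Green kernel are at most one too. -/
lemma integral_G_le_one' (μ y : ℝ) : ∫ x, M.G μ x y ∂M.ν ≤ 1 := by
  simp_rw [← M.G_symm μ _ y]
  exact M.integral_G_le_one (-μ) y

end Slab

/-! ### Linear integral equations with a substochastic kernel -/

section IntegralEquation

variable {X : Type*} [MeasurableSpace X] {ν : Measure X}

lemma abs_integral_kernel_mul_le {I : Set X} {k c d : X → ℝ} {lam N : ℝ}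
    (hk0 : ∀ y, 0 ≤ k y) (hki : Integrable k ν) (hk1 : ∫ y, k y ∂ν ≤ 1)
    (hI : ∀ᵐ y ∂ν, y ∈ I) (hc : ∀ᵐ y ∂ν, 0 ≤ c y ∧ c y ≤ lam) (hlam : 0 ≤ lam) (hN0 : 0 ≤ N)
    (hN : ∀ x ∈ I, |d x| ≤ N) : |∫ y, k y * (c y * d y) ∂ν| ≤ lam * N := by
  calc |∫ y, k y * (c y * d y) ∂ν| ≤ ∫ y, k y * (lam * N) ∂ν := by
        rw [← Real.norm_eq_abs]
        refine norm_integral_le_of_norm_le (hki.mul_const _) ?_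
        filter_upwards [hI, hc] with y hy hcy
        rw [Real.norm_eq_abs, abs_mul, abs_mul, abs_of_nonneg (hk0 y), abs_of_nonneg hcy.1]
        have := hN y hy
        have := hk0 y
        have := hcy.2
        gcongr
    _ = (∫ y, k y ∂ν) * (lam * N) := integral_mul_const _ _
    _ ≤ 1 * (lam * N) := by gcongr
    _ = lam * N := one_mul _

/-- Stability in the supremum norm: a bounded function whose defect in the homogeneous integral
equation is at most `R` is itself at most `R / (1 - lam)`. No measurability of the function
is required. -/
lemma abs_le_of_abs_defect_le {I : Set X} {k : X → X → ℝ} {c d : X → ℝ} {lam N R : ℝ}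
    (hk0 : ∀ x y, 0 ≤ k x y) (hki : ∀ x, Integrable (k x) ν) (hk1 : ∀ x, ∫ y, k x y ∂ν ≤ 1)
    (hI : ∀ᵐ y ∂ν, y ∈ I) (hc : ∀ᵐ y ∂ν, 0 ≤ c y ∧ c y ≤ lam) (hlam : 0 ≤ lam) (hlam1 : lam < 1)
    (hN : ∀ x ∈ I, |d x| ≤ N)
    (h : ∀ x ∈ I, |d x - ∫ y, k x y * (c y * d y) ∂ν| ≤ R) :
    ∀ x ∈ I, |d x| ≤ R / (1 - lam) := by
  intro x₀ hx₀
  have hR : 0 ≤ R := (abs_nonneg _).trans (h x₀ hx₀)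
  have hN0 : 0 ≤ N := (abs_nonneg _).trans (hN x₀ hx₀)
  have h1 : 0 < 1 - lam := by linarith
  -- applying the equation repeatedly shrinks the excess over `R / (1 - lam)` geometrically
  have key : ∀ j : ℕ, ∀ x ∈ I, |d x| ≤ R / (1 - lam) + lam ^ j * N := by
    intro j
    induction j with
    | zero =>
      intro x hx
      have := div_nonneg hR h1.le
      have := hN x hx
      simp only [pow_zero, one_mul]
      linarith
    | succ j ih =>
      intro x hx
      have h2 := abs_integral_kernel_mul_le (hk0 x) (hki x) (hk1 x) hI hc hlam
        (by positivity) ih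
      have h3 := abs_sub_abs_le_abs_sub (d x) (∫ y, k x y * (c y * d y) ∂ν)
      have h4 := h x hx
      have h5 : R + lam * (R / (1 - lam) + lam ^ j * N) = R / (1 - lam) + lam ^ (j + 1) * N := by
        field_simp
        ring
      linarith
  have hlim : Filter.Tendsto (fun j : ℕ => R / (1 - lam) + lam ^ j * N) Filter.atTop
      (nhds (R / (1 - lam) + 0 * N)) :=
    ((tendsto_pow_atTop_nhds_zero_of_lt_one hlam hlam1).mul_const N).const_add _
  rw [zero_mul, add_zero] at hlim
  exact ge_of_tendsto' hlim fun j => key j x₀ hx₀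

lemma sq_integral_kernel_mul_le {k f : X → ℝ} (hk0 : ∀ y, 0 ≤ k y) (hki : Integrable k ν)
    (hk1 : ∫ y, k y ∂ν ≤ 1) (h1 : Integrable (fun y => k y * f y) ν)
    (h2 : Integrable (fun y => k y * f y ^ 2) ν) :
    (∫ y, k y * f y ∂ν) ^ 2 ≤ ∫ y, k y * f y ^ 2 ∂ν := by
  set a := ∫ y, k y * f y ∂ν
  -- the integral of `k (f - a) ^ 2` is nonnegative
  have h3 : 0 ≤ ∫ y, k y * (f y - a) ^ 2 ∂ν :=
    integral_nonneg fun y => mul_nonneg (hk0 y) (sq_nonneg _)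
  have h4 : ∫ y, k y * (f y - a) ^ 2 ∂ν
      = ∫ y, k y * f y ^ 2 ∂ν - 2 * a * a + a ^ 2 * ∫ y, k y ∂ν := by
    calc ∫ y, k y * (f y - a) ^ 2 ∂ν
        = ∫ y, (k y * f y ^ 2 - 2 * a * (k y * f y)) + a ^ 2 * k y ∂ν := by
          congr 1
          ext y
          ring
      _ = _ := by
          rw [integral_add (f := fun y => k y * f y ^ 2 - 2 * a * (k y * f y))
            (h2.sub (h1.const_mul _)) (hki.const_mul _), integral_sub h2 (h1.const_mul _),
            integral_const_mul, integral_const_mul]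
  nlinarith [mul_le_mul_of_nonneg_left hk1 (sq_nonneg a)]

/-- Stability in mean square, by Schur's test: both the row sums and the column sums of the kernel
are at most one. -/
lemma integral_sq_le_of_eq_add [IsFiniteMeasure ν] {k : X → X → ℝ} {c e r : X → ℝ} {lam B N : ℝ}
    (hkm : Measurable (Function.uncurry k)) (hk0 : ∀ x y, 0 ≤ k x y) (hkB : ∀ x y, k x y ≤ B)
    (hk1 : ∀ x, ∫ y, k x y ∂ν ≤ 1) (hk1' : ∀ y, ∫ x, k x y ∂ν ≤ 1)
    (hc : ∀ᵐ y ∂ν, 0 ≤ c y ∧ c y ≤ lam) (hlam : 0 < lam) (hlam1 : lam < 1)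
    (hem : AEStronglyMeasurable e ν) (hN : ∀ᵐ x ∂ν, |e x| ≤ N)
    (hr : Integrable (fun x => r x ^ 2) ν)
    (h : ∀ᵐ x ∂ν, e x = ∫ y, k x y * (c y * e y) ∂ν + r x) :
    ∫ x, e x ^ 2 ∂ν ≤ ((1 - lam) ^ 2)⁻¹ * ∫ x, r x ^ 2 ∂ν := by
  have h1 : 0 < 1 - lam := by linarith
  have hkx : ∀ x, Measurable (k x) := fun x => hkm.comp measurable_prodMk_left
  have hki : ∀ x, Integrable (k x) ν := fun x =>
    Integrable.of_bound (hkx x).aestronglyMeasurable B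
      (Filter.Eventually.of_forall fun y => by
        rw [Real.norm_of_nonneg (hk0 x y)]; exact hkB x y)
  have heabs : Integrable (fun x => |e x|) ν :=
    Integrable.of_bound hem.norm N (by
      filter_upwards [hN] with x hx
      rw [Real.norm_eq_abs, abs_abs]; exact hx)
  have hesq : Integrable (fun x => e x ^ 2) ν := by
    refine Integrable.of_bound (hem.pow 2) (N ^ 2) ?_
    filter_upwards [hN] with x hx
    rw [Real.norm_eq_abs, abs_pow]
    gcongr
  have hke : ∀ x {f : X → ℝ}, Integrable f ν → Integrable (fun y => k x y * f y) ν := by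
    intro x f hf
    refine hf.bdd_mul (c := B) (hkx x).aestronglyMeasurable
      (Filter.Eventually.of_forall fun y => ?_)
    rw [Real.norm_of_nonneg (hk0 x y)]; exact hkB x y
  have hprod : Integrable (fun z : X × X => k z.1 z.2 * e z.2 ^ 2) (ν.prod ν) := by
    have h2 : Integrable (fun z : X × X => e z.2 ^ 2) (ν.prod ν) := hesq.comp_snd ν
    refine h2.bdd_mul (c := B) hkm.aestronglyMeasurable (Filter.Eventually.of_forall fun z => ?_)
    rw [Real.norm_of_nonneg (hk0 z.1 z.2)]; exact hkB z.1 z.2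
  have hpt : ∀ᵐ x ∂ν, e x ^ 2 ≤ lam * ∫ y, k x y * e y ^ 2 ∂ν + (1 - lam)⁻¹ * r x ^ 2 := by
    filter_upwards [h] with x hx
    set a := ∫ y, k x y * |e y| ∂ν with ha
    have ha0 : 0 ≤ a := integral_nonneg fun y => mul_nonneg (hk0 x y) (abs_nonneg _)
    have h3 : |∫ y, k x y * (c y * e y) ∂ν| ≤ lam * a := by
      rw [ha, ← integral_const_mul]
      rw [← Real.norm_eq_abs]
      refine norm_integral_le_of_norm_le ((hke x heabs).const_mul lam) ?_
      filter_upwards [hc] with y hy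
      rw [Real.norm_eq_abs, abs_mul, abs_mul, abs_of_nonneg (hk0 x y), abs_of_nonneg hy.1]
      calc k x y * (c y * |e y|) ≤ k x y * (lam * |e y|) := by
            have := hk0 x y
            have := hy.2
            gcongr
        _ = lam * (k x y * |e y|) := by ring
    have h4 : a ^ 2 ≤ ∫ y, k x y * e y ^ 2 ∂ν := by
      have := sq_integral_kernel_mul_le (f := fun y => |e y|) (hk0 x) (hki x) (hk1 x) (hke x heabs)
        (by simpa only [sq_abs] using hke x hesq)
      simpa only [sq_abs] using this
    have h5 : |e x| ≤ lam * a + |r x| := by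
      rw [hx]
      exact (abs_add_le _ _).trans (by gcongr)
    have h6 : e x ^ 2 ≤ (lam * a + |r x|) ^ 2 := by
      rw [← sq_abs]
      gcongr
    -- convexity of the square, with weights `lam` and `1 - lam`
    have h7 : (lam * a + |r x|) ^ 2 ≤ lam * a ^ 2 + (1 - lam)⁻¹ * r x ^ 2 := by
      rw [← sq_abs (r x)]
      set b := |r x|
      have : lam * a ^ 2 + (1 - lam)⁻¹ * b ^ 2 - (lam * a + b) ^ 2
          = lam * (1 - lam)⁻¹ * ((1 - lam) * a - b) ^ 2 := by
        field_simp
        ring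
      have : 0 ≤ lam * (1 - lam)⁻¹ * ((1 - lam) * a - b) ^ 2 := by positivity
      linarith
    have := mul_le_mul_of_nonneg_left h4 hlam.le
    linarith
  have hint : ∫ x, e x ^ 2 ∂ν
      ≤ lam * ∫ x, ∫ y, k x y * e y ^ 2 ∂ν ∂ν + (1 - lam)⁻¹ * ∫ x, r x ^ 2 ∂ν := by
    rw [← integral_const_mul, ← integral_const_mul,
      ← integral_add (hprod.integral_prod_left.const_mul lam) (hr.const_mul _)]
    exact integral_mono_ae hesq ((hprod.integral_prod_left.const_mul lam).add (hr.const_mul _)) hpt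
  have hswap : ∫ x, ∫ y, k x y * e y ^ 2 ∂ν ∂ν ≤ ∫ y, e y ^ 2 ∂ν := by
    rw [integral_integral_swap hprod]
    refine integral_mono hprod.integral_prod_right hesq fun y => ?_
    simp only
    rw [integral_mul_const]
    exact mul_le_of_le_one_left (sq_nonneg _) (hk1' y)
  have h8 : (1 - lam) * ∫ x, e x ^ 2 ∂ν ≤ (1 - lam)⁻¹ * ∫ x, r x ^ 2 ∂ν := by
    nlinarith
  calc ∫ x, e x ^ 2 ∂ν = (1 - lam)⁻¹ * ((1 - lam) * ∫ x, e x ^ 2 ∂ν) := by field_simp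
    _ ≤ (1 - lam)⁻¹ * ((1 - lam)⁻¹ * ∫ x, r x ^ 2 ∂ν) := by gcongr
    _ = ((1 - lam) ^ 2)⁻¹ * ∫ x, r x ^ 2 ∂ν := by
      field_simp

/-- The terms of the Neumann series of the integral equation with kernel `K p`, where `p` is a
parameter. -/
def neumannTerm {P : Type*} (ν : Measure X) (K : P → X → X → ℝ) (c : X → ℝ) (b : P → X → ℝ) :
    ℕ → P → X → ℝ
  | 0 => b
  | j + 1 => fun p x => ∫ y, K p x y * (c y * neumannTerm ν K c b j p y) ∂ν

/-- Existence for the integral equation, with a solution that depends measurably on a parameter,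
by the Neumann series. -/
lemma exists_measurable_solution [IsFiniteMeasure ν] {P : Type*} [MeasurableSpace P]
    {K : P → X → X → ℝ} {c : X → ℝ} {b : P → X → ℝ} {lam B : ℝ}
    (hKm : Measurable fun z : (P × X) × X => K z.1.1 z.1.2 z.2) (hK0 : ∀ p x y, 0 ≤ K p x y)
    (hKi : ∀ p x, Integrable (K p x) ν) (hK1 : ∀ p x, ∫ y, K p x y ∂ν ≤ 1)
    (hcm : Measurable c) (hc : ∀ᵐ y ∂ν, 0 ≤ c y ∧ c y ≤ lam) (hlam : 0 ≤ lam) (hlam1 : lam < 1)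
    (hbm : Measurable (Function.uncurry b)) (hb : ∀ p x, |b p x| ≤ B) (hB : 0 ≤ B) :
    ∃ Φ : P → X → ℝ, Measurable (Function.uncurry Φ) ∧ (∀ p x, |Φ p x| ≤ B / (1 - lam)) ∧
      ∀ p x, Φ p x = b p x + ∫ y, K p x y * (c y * Φ p y) ∂ν := by
  set g := neumannTerm ν K c b with hg
  have hgm : ∀ j, Measurable (Function.uncurry (g j)) := by
    intro j
    induction j with
    | zero => exact hbm
    | succ j ih =>
      have h1 : Measurable fun z : (P × X) × X => K z.1.1 z.1.2 z.2 * (c z.2 * g j z.1.1 z.2) :=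
        hKm.mul ((hcm.comp measurable_snd).mul
          (ih.comp (measurable_fst.fst.prodMk measurable_snd)))
      exact (h1.stronglyMeasurable.integral_prod_right' (ν := ν)).measurable
  have hgb : ∀ j p x, |g j p x| ≤ lam ^ j * B := by
    intro j
    induction j with
    | zero =>
      intro p x
      rw [pow_zero, one_mul]
      exact hb p x
    | succ j ih =>
      intro p x
      have := abs_integral_kernel_mul_le (I := Set.univ) (d := g j p) (hK0 p x) (hKi p x) (hK1 p x)
        (by simp) hc hlam (by positivity : 0 ≤ lam ^ j * B) (fun y _ => ih p y)
      rw [pow_succ', mul_assoc]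
      exact this
  have hgeom : HasSum (fun j : ℕ => lam ^ j * B) (B / (1 - lam)) := by
    have := (hasSum_geometric_of_lt_one hlam hlam1).mul_right B
    rwa [inv_mul_eq_div] at this
  have hsum : ∀ p x, Summable fun j => g j p x := fun p x =>
    Summable.of_norm_bounded hgeom.summable fun j => hgb j p x
  refine ⟨fun p x => ∑' j, g j p x, ?_, fun p x => ?_, fun p x => ?_⟩
  · refine measurable_of_tendsto_metrizable
      (f := fun n z => ∑ j ∈ Finset.range n, Function.uncurry (g j) z) (fun n => ?_) ?_
    · exact Finset.measurable_sum _ fun j _ => hgm j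
    · rw [tendsto_pi_nhds]
      rintro ⟨p, x⟩
      exact (hsum p x).hasSum.tendsto_sum_nat
  · exact tsum_of_norm_bounded (f := fun j => g j p x) hgeom fun j => hgb j p x
  · have hgx : ∀ j, Measurable (g j p) := fun j => (hgm j).comp measurable_prodMk_left
    have hFi : ∀ j, Integrable (fun y => K p x y * (c y * g j p y)) ν := by
      intro j
      refine (hKi p x).mul_bdd (c := lam * (lam ^ j * B)) (hcm.mul (hgx j)).aestronglyMeasurable ?_
      filter_upwards [hc] with y hy
      rw [Real.norm_eq_abs, abs_mul, abs_of_nonneg hy.1]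
      exact mul_le_mul hy.2 (hgb j p y) (abs_nonneg _) hlam
    have hFn : ∀ j, ∫ y, ‖K p x y * (c y * g j p y)‖ ∂ν ≤ lam * (lam ^ j * B) := by
      intro j
      calc ∫ y, ‖K p x y * (c y * g j p y)‖ ∂ν ≤ ∫ y, K p x y * (lam * (lam ^ j * B)) ∂ν := by
            refine integral_mono_ae (hFi j).norm ((hKi p x).mul_const _) ?_
            filter_upwards [hc] with y hy
            rw [Real.norm_eq_abs, abs_mul, abs_mul, abs_of_nonneg (hK0 p x y), abs_of_nonneg hy.1]
            exact mul_le_mul_of_nonneg_left (mul_le_mul hy.2 (hgb j p y) (abs_nonneg _) hlam)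
              (hK0 p x y)
        _ = (∫ y, K p x y ∂ν) * (lam * (lam ^ j * B)) := integral_mul_const _ _
        _ ≤ 1 * (lam * (lam ^ j * B)) := by
            have := hK1 p x
            gcongr
        _ = _ := one_mul _
    have hFs : Summable fun j => ∫ y, ‖K p x y * (c y * g j p y)‖ ∂ν :=
      Summable.of_nonneg_of_le (fun j => integral_nonneg fun y => norm_nonneg _) hFn
        (hgeom.summable.mul_left lam)
    have h1 := hasSum_integral_of_summable_integral_norm hFi hFs
    have h2 : ∀ y, ∑' j, K p x y * (c y * g j p y) = K p x y * (c y * ∑' j, g j p y) := by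
      intro y
      rw [tsum_mul_left, tsum_mul_left]
    simp only [h2] at h1
    beta_reduce
    rw [(hsum p x).tsum_eq_zero_add, ← h1.tsum_eq]
    rfl

end IntegralEquation

/-! ### Stratified sampling with symmetric ordinates -/

section Sampling

variable {m : ℕ} {δ : ℝ} {t : Fin (m + 1) → ℝ}

/-- The weighted sum of the values of `f` at the symmetric ordinates generated by `u`. -/
def ordinateSum (δ : ℝ) (t : Fin (m + 1) → ℝ) (u : Fin m → ℝ) (f : ℝ → ℝ) : ℝ :=
  ∑ l, weight δ t l * f (symOrdinate u l)

/-- The length of a half cell, relative to the length of the velocity space. -/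
def halfWeight (δ : ℝ) (t : Fin (m + 1) → ℝ) (l : Fin m) : ℝ :=
  (t l.succ - t l.castSucc) / (2 * (1 - δ))

lemma volume_velocitySpace (hδ0 : 0 < δ) (hδ1 : δ < 1) :
    volume.real (velocitySpace δ) = 2 * (1 - δ) := by
  unfold velocitySpace
  rw [measureReal_union ?_ measurableSet_Ioc (by simp) (by simp),
    Real.volume_real_Ico_of_le (by linarith),
    Real.volume_real_Ioc_of_le (by linarith)]
  · ring
  · rw [Set.disjoint_left]
    intro x h1 h2
    linarith [h1.2, h2.1]

namespace IsPartition

variable (ht : IsPartition δ t)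
include ht

lemma lt_succ (l : Fin m) : t l.castSucc < t l.succ := ht.1 Fin.castSucc_lt_succ

lemma left_ge (l : Fin (m + 1)) : -1 ≤ t l := by
  rw [← ht.2.1]
  exact ht.1.monotone (Fin.zero_le l)

lemma right_le (l : Fin (m + 1)) : t l ≤ -δ := by
  rw [← ht.2.2]
  exact ht.1.monotone (Fin.le_last l)

lemma halfCell_subset (l : Fin m) : halfCell t l ⊆ Set.Ico (-1) (-δ) := fun _ hv =>
  ⟨(ht.left_ge _).trans hv.1, hv.2.trans_le (ht.right_le _)⟩

lemma weight_castAdd (hδ0 : 0 < δ) (hδ1 : δ < 1) (l : Fin m) :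
    weight δ t (Fin.castAdd m l) = halfWeight δ t l := by
  unfold weight halfWeight cell
  rw [volume_velocitySpace hδ0 hδ1, Fin.append_left, halfCell,
    Real.volume_real_Ico_of_le (ht.lt_succ l).le]

lemma weight_natAdd (hδ0 : 0 < δ) (hδ1 : δ < 1) (l : Fin m) :
    weight δ t (Fin.natAdd m l) = halfWeight δ t l.rev := by
  unfold weight halfWeight cell
  rw [volume_velocitySpace hδ0 hδ1, Fin.append_right]
  have : {v : ℝ | -v ∈ halfCell t l.rev} = Set.Ioc (-t l.rev.succ) (-t l.rev.castSucc) := by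
    ext v
    simp only [halfCell, Set.mem_ofPred_eq, Set.mem_Ico, Set.mem_Ioc]
    constructor <;> rintro ⟨h1, h2⟩ <;> constructor <;> linarith
  rw [this, Real.volume_real_Ioc_of_le (by linarith [ht.lt_succ l.rev])]
  ring

lemma halfWeight_pos (hδ1 : δ < 1) (l : Fin m) : 0 < halfWeight δ t l :=
  div_pos (sub_pos.mpr (ht.lt_succ l)) (by linarith)

lemma weight_nonneg (hδ0 : 0 < δ) (hδ1 : δ < 1) (l : Fin (m + m)) : 0 ≤ weight δ t l := by
  refine Fin.addCases (fun l => ?_) (fun l => ?_) l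
  · rw [ht.weight_castAdd hδ0 hδ1]
    exact (ht.halfWeight_pos hδ1 _).le
  · rw [ht.weight_natAdd hδ0 hδ1]
    exact (ht.halfWeight_pos hδ1 _).le

/-- Opposite ordinates carry the same weight, so that the sum runs over pairs. -/
lemma ordinateSum_eq (hδ0 : 0 < δ) (hδ1 : δ < 1) (u : Fin m → ℝ) (f : ℝ → ℝ) :
    ordinateSum δ t u f = ∑ l, halfWeight δ t l * (f (u l) + f (-u l)) := by
  unfold ordinateSum
  rw [Fin.sum_univ_add]
  simp only [ht.weight_castAdd hδ0 hδ1, ht.weight_natAdd hδ0 hδ1, symOrdinate, Fin.append_left,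
    Fin.append_right, mul_add, Finset.sum_add_distrib]
  congr 1
  exact Equiv.sum_comp Fin.revPerm fun l => halfWeight δ t l * f (-u l)

lemma sum_integral_halfCell {f : ℝ → ℝ} (hf : LocallyIntegrable f) :
    ∑ l : Fin m, ∫ v in (t l.castSucc)..(t l.succ), f v = ∫ v in (-1)..(-δ), f v := by
  have h1 : ∀ a b, IntervalIntegrable f volume a b := fun a b =>
    (hf.integrableOn_isCompact isCompact_uIcc).intervalIntegrable
  set a : ℕ → ℝ := fun k => if h : k < m + 1 then t ⟨k, h⟩ else 0 with ha
  have h2 := intervalIntegral.sum_integral_adjacent_intervals (f := f) (μ := volume) (a := a)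
    (n := m) (fun k _ => h1 _ _)
  have h3 : a 0 = -1 := by
    rw [← ht.2.1]
    simp [ha]
  have h4 : a m = -δ := by
    rw [← ht.2.2]
    simp only [ha, Nat.lt_succ_self, dif_pos]
    rfl
  rw [h3, h4, Finset.sum_range] at h2
  rw [← h2]
  refine Finset.sum_congr rfl fun l _ => ?_
  have h5 : a (l : ℕ) = t l.castSucc := by
    simp only [ha]
    rw [dif_pos (by omega)]
    rfl
  have h6 : a ((l : ℕ) + 1) = t l.succ := by
    simp only [ha]
    rw [dif_pos (by omega)]
    rfl
  rw [h5, h6]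

end IsPartition

lemma locallyIntegrable_of_bounded {f : ℝ → ℝ} {B : ℝ} (hf : Measurable f) (hB : ∀ v, |f v| ≤ B) :
    LocallyIntegrable f :=
  (locallyIntegrable_const B).mono hf.aestronglyMeasurable
    (Filter.Eventually.of_forall fun v => by
      rw [Real.norm_eq_abs]
      exact (hB v).trans (le_abs_self B))

lemma setAverage_velocitySpace (hδ0 : 0 < δ) (hδ1 : δ < 1) {f : ℝ → ℝ}
    (hf : LocallyIntegrable f) :
    ⨍ v in velocitySpace δ, f v = (2 * (1 - δ))⁻¹ * ∫ v in (-1)..(-δ), (f v + f (-v)) := by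
  have h1 : ∀ a b, IntervalIntegrable f volume a b := fun a b =>
    (hf.integrableOn_isCompact isCompact_uIcc).intervalIntegrable
  rw [setAverage_eq, volume_velocitySpace hδ0 hδ1, smul_eq_mul]
  congr 1
  have h2 : IntervalIntegrable (fun v => f (-v)) volume (-1) (-δ) := by
    have := (h1 1 δ).comp_sub_left 0
    simpa using this
  rw [intervalIntegral.integral_add (h1 _ _) h2, intervalIntegral.integral_comp_neg, neg_neg,
    neg_neg,
    intervalIntegral.integral_of_le (by linarith), intervalIntegral.integral_of_le (by linarith),
    ← integral_Icc_eq_integral_Ioc, integral_Icc_eq_integral_Ico]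
  unfold velocitySpace
  refine setIntegral_union ?_ measurableSet_Ioc ?_ ?_
  · rw [Set.disjoint_left]
    intro x h1 h2
    linarith [h1.2, h2.1]
  · exact (hf.integrableOn_isCompact isCompact_Icc).mono_set Set.Ico_subset_Icc_self
  · exact (hf.integrableOn_isCompact isCompact_Icc).mono_set Set.Ioc_subset_Icc_self

variable {Ω : Type*} [MeasurableSpace Ω] {P : Measure Ω}
  {U : Fin m → Ω → ℝ}

lemma ae_mem_halfCell (hUm : ∀ l, Measurable (U l))
    (hU : ∀ l, pdf.IsUniform (U l) (halfCell t l) P volume) :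
    ∀ᵐ ω ∂P, ∀ l, U l ω ∈ halfCell t l := by
  rw [ae_all_iff]
  intro l
  have h1 : ∀ᵐ v ∂(P.map (U l)), v ∈ halfCell t l := by
    rw [hU l]
    exact ae_cond_mem measurableSet_Ico
  exact ae_of_ae_map (hUm l).aemeasurable h1

lemma integral_comp_isUniform (ht : IsPartition δ t) (l : Fin m) (hUm : Measurable (U l))
    (hU : pdf.IsUniform (U l) (halfCell t l) P volume) {h : ℝ → ℝ} (hh : Measurable h) :
    ∫ ω, h (U l ω) ∂P =
      (t l.succ - t l.castSucc)⁻¹ * ∫ v in (t l.castSucc)..(t l.succ), h v := by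
  have hlt := ht.lt_succ l
  rw [← integral_map hUm.aemeasurable hh.aestronglyMeasurable, hU, ProbabilityTheory.cond,
    integral_smul_measure, intervalIntegral.integral_of_le hlt.le, ← integral_Icc_eq_integral_Ioc,
    integral_Icc_eq_integral_Ico, smul_eq_mul]
  congr 1
  rw [halfCell, Real.volume_Ico, ENNReal.toReal_inv, ENNReal.toReal_ofReal (by linarith)]

lemma integrable_of_abs_le {α : Type*} [MeasurableSpace α] {μ : Measure α} [IsFiniteMeasure μ]
    {f : α → ℝ} {B : ℝ} (hf : AEStronglyMeasurable f μ) (hB : ∀ a, |f a| ≤ B) : Integrable f μ :=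
  Integrable.of_bound hf B (Filter.Eventually.of_forall hB)

/-- Stratified sampling is unbiased. -/
lemma integral_ordinateSum [IsProbabilityMeasure P] (hδ0 : 0 < δ) (hδ1 : δ < 1)
    (ht : IsPartition δ t)
    (hUm : ∀ l, Measurable (U l)) (hU : ∀ l, pdf.IsUniform (U l) (halfCell t l) P volume)
    {f : ℝ → ℝ} (hf : Measurable f) {B : ℝ} (hB : ∀ v, |f v| ≤ B) :
    ∫ ω, ordinateSum δ t (fun l => U l ω) f ∂P = ⨍ v in velocitySpace δ, f v := by
  have hh : Measurable fun v => f v + f (-v) := hf.add (hf.comp measurable_neg)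
  have hhB : ∀ v, |f v + f (-v)| ≤ 2 * B := fun v => by
    have h1 := hB v
    have h2 := hB (-v)
    have h3 := abs_add_le (f v) (f (-v))
    linarith
  simp only [ht.ordinateSum_eq hδ0 hδ1]
  rw [integral_finsetSum]
  · rw [setAverage_velocitySpace hδ0 hδ1 (locallyIntegrable_of_bounded hf hB),
      ← ht.sum_integral_halfCell (locallyIntegrable_of_bounded hh hhB), Finset.mul_sum]
    refine Finset.sum_congr rfl fun l _ => ?_
    have hlt := ht.lt_succ l
    have hne : t l.succ - t l.castSucc ≠ 0 := by linarith
    have hne' : 2 * (1 - δ) ≠ 0 := by linarith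
    rw [integral_const_mul,
      integral_comp_isUniform (h := fun v => f v + f (-v)) ht l (hUm l) (hU l) hh,
      halfWeight]
    field_simp
  · intro l _
    exact (integrable_of_abs_le (hh.comp (hUm l)).aestronglyMeasurable fun ω => hhB _).const_mul _

/-- The variance of stratified sampling: for Lipschitz functions each of the `O(n)` independent
terms has weight `O(n⁻¹)` and oscillates by `O(n⁻¹)` on its cell. -/
lemma integral_sq_ordinateSum_sub_le [IsProbabilityMeasure P] (hδ0 : 0 < δ) (hδ1 : δ < 1)
    (ht : IsPartition δ t) (hm : 0 < m)
    {A : ℝ} (hA : ∀ l, rescaledWeight δ t l ≤ A)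
    (hUm : ∀ l, Measurable (U l)) (hind : iIndepFun U P)
    (hU : ∀ l, pdf.IsUniform (U l) (halfCell t l) P volume)
    {f : ℝ → ℝ} (hf : Measurable f) {B L : ℝ} (hB : ∀ v, |f v| ≤ B) (hL0 : 0 ≤ L)
    (hL : ∀ v ∈ velocitySpace δ, ∀ w ∈ velocitySpace δ, 0 < v * w → |f v - f w| ≤ L * |v - w|) :
    ∫ ω, (ordinateSum δ t (fun l => U l ω) f - ⨍ v in velocitySpace δ, f v) ^ 2 ∂P
      ≤ 8 * A ^ 4 * L ^ 2 / ((m + m : ℕ) : ℝ) ^ 3 := by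
  set n : ℝ := ((m + m : ℕ) : ℝ) with hn
  have hmR : (0 : ℝ) < m := by exact_mod_cast hm
  have hn0 : 0 < n := by
    rw [hn]
    push_cast
    linarith
  set h : ℝ → ℝ := fun v => f v + f (-v) with hh_def
  have hh : Measurable h := hf.add (hf.comp measurable_neg)
  have hhB : ∀ v, |h v| ≤ 2 * B := fun v => by
    have h1 := hB v
    have h2 := hB (-v)
    have h3 := abs_add_le (f v) (f (-v))
    simp only [hh_def]
    linarith
  have hw : ∀ l, halfWeight δ t l ≤ A / n := by
    intro l
    have := hA (Fin.castAdd m l)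
    rw [rescaledWeight, ht.weight_castAdd hδ0 hδ1] at this
    rw [le_div_iff₀ hn0]
    linarith
  set X : Fin m → Ω → ℝ := fun l ω => halfWeight δ t l * h (U l ω) with hX
  have hXm : ∀ l, Measurable (X l) := fun l => (hh.comp (hUm l)).const_mul _
  have hXL : ∀ l, MemLp (X l) 2 P := by
    intro l
    refine MemLp.of_bound (hXm l).aestronglyMeasurable (halfWeight δ t l * (2 * B))
      (Filter.Eventually.of_forall fun ω => ?_)
    rw [Real.norm_eq_abs, abs_mul, abs_of_pos (ht.halfWeight_pos hδ1 l)]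
    exact mul_le_mul_of_nonneg_left (hhB _) (ht.halfWeight_pos hδ1 l).le
  have hsum : (fun ω => ordinateSum δ t (fun l => U l ω) f) = ∑ l, X l := by
    ext ω
    rw [ht.ordinateSum_eq hδ0 hδ1, Finset.sum_apply]
  have hvar : ∫ ω, (ordinateSum δ t (fun l => U l ω) f - ⨍ v in velocitySpace δ, f v) ^ 2 ∂P =
      ∑ l, variance (X l) P := by
    rw [← IndepFun.variance_sum (fun l _ => hXL l), ← hsum, variance_eq_integral,
      integral_ordinateSum hδ0 hδ1 ht hUm hU hf hB]
    · rw [hsum]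
      exact (by fun_prop : Measurable (∑ l, X l)).aemeasurable
    · intro i _ j _ hij
      exact (hind.indepFun hij).comp (φ := fun v => halfWeight δ t i * h v)
        (ψ := fun v => halfWeight δ t j * h v) (hh.const_mul _) (hh.const_mul _)
  rw [hvar]
  have hmem := ae_mem_halfCell hUm hU
  have hA0 : 0 ≤ A / n := (ht.halfWeight_pos hδ1 ⟨0, hm⟩).le.trans (hw _)
  have hone : ∀ l, variance (X l) P ≤ (A / n) ^ 2 * (4 * L * (A / n)) ^ 2 := by
    intro l
    have hlt := ht.lt_succ l
    set d := 4 * L * (A / n) with hd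
    -- on its cell, `h` stays within `d` of its value at the left end
    have hosc : ∀ᵐ ω ∂P, h (U l ω) ∈ Set.Icc (h (t l.castSucc) - d) (h (t l.castSucc) + d) := by
      filter_upwards [hmem] with ω hω
      have h1 : U l ω ∈ Set.Ico (-1) (-δ) := ht.halfCell_subset l (hω l)
      have h2 : t l.castSucc ∈ Set.Ico (-1) (-δ) :=
        ht.halfCell_subset l ⟨le_rfl, hlt⟩
      have h3 := hL _ (Or.inl h1) _ (Or.inl h2)
        (mul_pos_of_neg_of_neg (by linarith [h1.2]) (by linarith [h2.2]))
      have h4 := hL (-U l ω) (Or.inr ⟨by linarith [h1.2], by linarith [h1.1]⟩) (-t l.castSucc)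
        (Or.inr ⟨by linarith [h2.2], by linarith [h2.1]⟩)
        (mul_pos (by linarith [h1.2]) (by linarith [h2.2]))
      rw [show -U l ω - -t l.castSucc = -(U l ω - t l.castSucc) by ring, abs_neg] at h4
      have h5 : |U l ω - t l.castSucc| ≤ 2 * (A / n) := by
        have h6 := hω l
        rw [abs_of_nonneg (by linarith [h6.1])]
        have h7 : t l.succ - t l.castSucc = halfWeight δ t l * (2 * (1 - δ)) := by
          unfold halfWeight
          rw [div_mul_cancel₀ _ (by linarith)]
        have h8 : halfWeight δ t l * (2 * (1 - δ)) ≤ A / n * (2 * (1 - δ)) :=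
          mul_le_mul_of_nonneg_right (hw l) (by linarith)
        have h9 : A / n * (2 * (1 - δ)) ≤ A / n * 2 :=
          mul_le_mul_of_nonneg_left (by linarith) hA0
        linarith [h6.2]
      have h6 : L * |U l ω - t l.castSucc| ≤ L * (2 * (A / n)) :=
        mul_le_mul_of_nonneg_left h5 hL0
      have h7 := abs_le.mp (h3.trans h6)
      have h8 := abs_le.mp (h4.trans h6)
      simp only [hh_def, Set.mem_Icc]
      constructor <;> linarith [h7.1, h7.2, h8.1, h8.2]
    have h1 := variance_le_sq_of_bounded hosc (hh.comp (hUm l)).aemeasurable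
    have h2 : ((h (t l.castSucc) + d - (h (t l.castSucc) - d)) / 2) ^ 2 = d ^ 2 := by ring
    rw [h2] at h1
    rw [hX]
    simp only
    rw [variance_const_mul]
    have h3 := (ht.halfWeight_pos hδ1 l).le
    have h4 := hw l
    exact mul_le_mul (by gcongr) h1 (variance_nonneg _ _) (by positivity)
  calc ∑ l, variance (X l) P ≤ ∑ _l : Fin m, (A / n) ^ 2 * (4 * L * (A / n)) ^ 2 :=
        Finset.sum_le_sum fun l _ => hone l
    _ = m * ((A / n) ^ 2 * (4 * L * (A / n)) ^ 2) := by simp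
    _ = 8 * A ^ 4 * L ^ 2 / n ^ 3 := by
      have : n = 2 * m := by
        rw [hn]
        push_cast
        ring
      rw [this]
      field_simp
      ring

end Sampling

namespace Slab

variable (M : Slab)

/-! ### Angular averages and the equation for the density -/

/-- Boundary values as a function of the velocity, bounded on the truncated velocity space and
Lipschitz on each of its halves. -/
structure Inflow where
  /-- The boundary value for each velocity. -/
  val : ℝ → ℝ
  meas : Measurable val
  /-- A bound of the boundary values. -/
  bd : ℝ
  /-- A Lipschitz constant of the boundary values. -/
  lip : ℝ
  bd_nonneg : 0 ≤ bd
  lip_nonneg : 0 ≤ lip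
  abs_le : ∀ μ ∈ M.S, |val μ| ≤ bd
  abs_sub_le : ∀ μ ∈ M.S, ∀ μ' ∈ M.S, 0 < μ * μ' → |val μ - val μ'| ≤ lip * |μ - μ'|

variable {M} (g : M.Inflow)

lemma abs_val_mul_att_le (μ x : ℝ) : |g.val μ * M.att μ x| ≤ g.bd := by
  by_cases h : μ ∈ M.S
  · rw [abs_mul, abs_of_nonneg (M.att_nonneg μ x)]
    exact (mul_le_mul (g.abs_le μ h) (M.att_le_one μ x) (M.att_nonneg μ x) g.bd_nonneg).trans
      (mul_one _).le
  · have : M.att μ x = 0 := if_neg (by tauto)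
    rw [this, mul_zero, abs_zero]
    exact g.bd_nonneg

/-- The solution of the transport equation with velocity `μ`, boundary values `g` and source
`σT * f`, at the point `x`. -/
def ang (f : ℝ → ℝ) (μ x : ℝ) : ℝ := g.val μ * M.att μ x + ∫ y, M.G μ x y * f y ∂M.ν

lemma abs_integral_G_mul_le {f : ℝ → ℝ} (hf : Integrable f M.ν) (μ x : ℝ) :
    |∫ y, M.G μ x y * f y ∂M.ν| ≤ M.δ⁻¹ * ∫ y, |f y| ∂M.ν := by
  rw [← integral_const_mul, ← Real.norm_eq_abs]
  refine norm_integral_le_of_norm_le (hf.abs.const_mul _) (Filter.Eventually.of_forall fun y => ?_)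
  rw [Real.norm_eq_abs, abs_mul]
  exact mul_le_mul_of_nonneg_right (M.abs_G_le μ x y) (abs_nonneg _)

lemma abs_ang_le {f : ℝ → ℝ} (hf : Integrable f M.ν) (μ x : ℝ) :
    |ang g f μ x| ≤ g.bd + M.δ⁻¹ * ∫ y, |f y| ∂M.ν :=
  (abs_add_le _ _).trans (add_le_add (abs_val_mul_att_le g μ x) (abs_integral_G_mul_le hf μ x))

lemma abs_ang_sub_le {f : ℝ → ℝ} (hf : Integrable f M.ν) {μ μ' : ℝ} (h : μ ∈ M.S) (h' : μ' ∈ M.S)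
    (hs : 0 < μ * μ') (x : ℝ) :
    |ang g f μ x - ang g f μ' x| ≤
      (g.lip + g.bd * (M.depth * (M.δ⁻¹) ^ 2) + M.lipG * ∫ y, |f y| ∂M.ν) * |μ - μ'| := by
  have h1 : |g.val μ * M.att μ x - g.val μ' * M.att μ' x| ≤
      (g.lip + g.bd * (M.depth * (M.δ⁻¹) ^ 2)) * |μ - μ'| := by
    calc |g.val μ * M.att μ x - g.val μ' * M.att μ' x|
        = |(g.val μ - g.val μ') * M.att μ x + g.val μ' * (M.att μ x - M.att μ' x)| := by ring_nf
      _ ≤ |g.val μ - g.val μ'| * M.att μ x + |g.val μ'| * |M.att μ x - M.att μ' x| := by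
          refine (abs_add_le _ _).trans ?_
          rw [abs_mul, abs_mul, abs_of_nonneg (M.att_nonneg μ x)]
      _ ≤ (g.lip * |μ - μ'|) * 1 + g.bd * (M.depth * (M.δ⁻¹) ^ 2 * |μ - μ'|) := by
          refine add_le_add (mul_le_mul (g.abs_sub_le μ h μ' h' hs) (M.att_le_one μ x)
            (M.att_nonneg μ x) (mul_nonneg g.lip_nonneg (abs_nonneg _)))
            (mul_le_mul (g.abs_le μ' h') (M.abs_att_sub_le h h' hs x) (abs_nonneg _) g.bd_nonneg)
      _ = _ := by ring
  have h2 : |∫ y, M.G μ x y * f y ∂M.ν - ∫ y, M.G μ' x y * f y ∂M.ν| ≤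
      (M.lipG * ∫ y, |f y| ∂M.ν) * |μ - μ'| := by
    rw [← integral_sub (M.integrable_G_mul hf μ x) (M.integrable_G_mul hf μ' x), mul_right_comm,
      ← integral_const_mul, ← Real.norm_eq_abs]
    refine norm_integral_le_of_norm_le (hf.abs.const_mul _)
      (Filter.Eventually.of_forall fun y => ?_)
    rw [Real.norm_eq_abs, ← sub_mul, abs_mul]
    exact mul_le_mul_of_nonneg_right (M.abs_G_sub_le h h' hs x y) (abs_nonneg _)
  calc |ang g f μ x - ang g f μ' x|
      = |(g.val μ * M.att μ x - g.val μ' * M.att μ' x) +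
          (∫ y, M.G μ x y * f y ∂M.ν - ∫ y, M.G μ' x y * f y ∂M.ν)| := by
        unfold ang
        ring_nf
    _ ≤ _ := (abs_add_le _ _).trans (add_le_add h1 h2)
    _ = _ := by ring

lemma measurable_ang {f : ℝ → ℝ} (hf : Integrable f M.ν) :
    Measurable fun p : ℝ × ℝ => ang g f p.1 p.2 := by
  refine ((g.meas.comp measurable_fst).mul M.measurable_att).add ?_
  have h1 : ∀ p : ℝ × ℝ, ∫ y, M.G p.1 p.2 y * f y ∂M.ν =
      ∫ y, M.G p.1 p.2 y * hf.1.mk f y ∂M.ν := fun p =>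
    integral_congr_ae (by filter_upwards [hf.1.ae_eq_mk] with y hy; rw [hy])
  simp only [h1]
  have h2 : Measurable fun z : (ℝ × ℝ) × ℝ => M.G z.1.1 z.1.2 z.2 * hf.1.mk f z.2 :=
    (M.measurable_G_comp measurable_fst.fst measurable_fst.snd measurable_snd).mul
      (hf.1.stronglyMeasurable_mk.measurable.comp measurable_snd)
  exact (h2.stronglyMeasurable.integral_prod_right' (ν := M.ν)).measurable

variable (M) in
/-- The average of the Green kernel over the velocities distributed according to `ρ`. -/
def avgG (ρ : Measure ℝ) (x y : ℝ) : ℝ := ∫ μ, M.G μ x y ∂ρ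

section Average

variable (ρ : Measure ℝ) [IsProbabilityMeasure ρ]

lemma integrable_G_left (x y : ℝ) : Integrable (fun μ => M.G μ x y) ρ :=
  integrable_of_abs_le (M.measurable_G_comp measurable_id measurable_const
    measurable_const).aestronglyMeasurable fun μ => M.abs_G_le μ x y

omit [IsProbabilityMeasure ρ] in
lemma avgG_nonneg (x y : ℝ) : 0 ≤ M.avgG ρ x y := integral_nonneg fun μ => M.G_nonneg μ x y

lemma avgG_le (x y : ℝ) : M.avgG ρ x y ≤ M.δ⁻¹ := by
  calc M.avgG ρ x y ≤ ∫ _μ, M.δ⁻¹ ∂ρ :=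
        integral_mono (integrable_G_left ρ x y) (integrable_const _) fun μ => M.G_le μ x y
    _ = M.δ⁻¹ := by simp

lemma measurable_avgG : Measurable (Function.uncurry (M.avgG ρ)) := by
  have h : Measurable fun z : (ℝ × ℝ) × ℝ => M.G z.2 z.1.1 z.1.2 :=
    M.measurable_G_comp measurable_snd measurable_fst.fst measurable_fst.snd
  exact (h.stronglyMeasurable.integral_prod_right' (ν := ρ)).measurable

lemma integrable_avgG (x : ℝ) : Integrable (M.avgG ρ x) M.ν :=
  integrable_of_abs_le ((measurable_avgG ρ).comp measurable_prodMk_left).aestronglyMeasurable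
    (B := M.δ⁻¹) fun y => by
      rw [abs_of_nonneg (avgG_nonneg ρ x y)]
      exact avgG_le ρ x y

lemma integrable_avgG_mul {f : ℝ → ℝ} (hf : Integrable f M.ν) (x : ℝ) :
    Integrable (fun y => M.avgG ρ x y * f y) M.ν := by
  refine hf.bdd_mul (c := M.δ⁻¹) (integrable_avgG ρ x).1 (Filter.Eventually.of_forall fun y => ?_)
  rw [Real.norm_of_nonneg (avgG_nonneg ρ x y)]
  exact avgG_le ρ x y

lemma integral_avgG_mul {f : ℝ → ℝ} (hf : Integrable f M.ν) (x : ℝ) :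
    ∫ y, M.avgG ρ x y * f y ∂M.ν = ∫ μ, ∫ y, M.G μ x y * f y ∂M.ν ∂ρ := by
  have h : Integrable (fun z : ℝ × ℝ => M.G z.1 x z.2 * f z.2) (ρ.prod M.ν) := by
    refine (hf.comp_snd ρ).bdd_mul (c := M.δ⁻¹) ?_
      (Filter.Eventually.of_forall fun z => M.abs_G_le _ _ _)
    exact (M.measurable_G_comp measurable_fst measurable_const measurable_snd).aestronglyMeasurable
  rw [integral_integral_swap h]
  simp only [avgG, integral_mul_const]

lemma integral_avgG_le_one (x : ℝ) : ∫ y, M.avgG ρ x y ∂M.ν ≤ 1 := by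
  have h := integral_avgG_mul (M := M) ρ (integrable_const (1 : ℝ)) x
  simp only [mul_one] at h
  rw [h]
  calc ∫ μ, ∫ y, M.G μ x y ∂M.ν ∂ρ ≤ ∫ _μ, (1 : ℝ) ∂ρ := by
        refine integral_mono_of_nonneg (Filter.Eventually.of_forall fun μ => ?_)
          (integrable_const _) (Filter.Eventually.of_forall fun μ => M.integral_G_le_one μ x)
        exact integral_nonneg fun y => M.G_nonneg μ x y
    _ = 1 := by simp

lemma integral_avgG_le_one' (y : ℝ) : ∫ x, M.avgG ρ x y ∂M.ν ≤ 1 := by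
  have h : Integrable (fun z : ℝ × ℝ => M.G z.1 z.2 y) (ρ.prod M.ν) :=
    integrable_of_abs_le (M.measurable_G_comp measurable_fst measurable_snd
      measurable_const).aestronglyMeasurable fun z => M.abs_G_le _ _ _
  unfold avgG
  rw [← integral_integral_swap h]
  calc ∫ μ, ∫ x, M.G μ x y ∂M.ν ∂ρ ≤ ∫ _μ, (1 : ℝ) ∂ρ := by
        refine integral_mono_of_nonneg (Filter.Eventually.of_forall fun μ => ?_)
          (integrable_const _) (Filter.Eventually.of_forall fun μ => M.integral_G_le_one' μ y)
        exact integral_nonneg fun x => M.G_nonneg μ x y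
    _ = 1 := by simp

lemma integrable_ang {f : ℝ → ℝ} (hf : Integrable f M.ν) (x : ℝ) :
    Integrable (fun μ => ang g f μ x) ρ :=
  integrable_of_abs_le ((measurable_ang g hf).comp
    (measurable_id.prodMk measurable_const)).aestronglyMeasurable fun μ => abs_ang_le g hf μ x

lemma abs_integral_ang_le {f : ℝ → ℝ} (hf : Integrable f M.ν) (x : ℝ) :
    |∫ μ, ang g f μ x ∂ρ| ≤ g.bd + M.δ⁻¹ * ∫ y, |f y| ∂M.ν := by
  have h := norm_integral_le_of_norm_le (f := fun μ => ang g f μ x) (integrable_const (μ := ρ)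
    (g.bd + M.δ⁻¹ * ∫ y, |f y| ∂M.ν)) (Filter.Eventually.of_forall fun μ => abs_ang_le g hf μ x)
  simpa using h

/-- The angular average depends affinely on the source. -/
lemma integral_ang_add {f f' : ℝ → ℝ} (hf : Integrable f M.ν) (hf' : Integrable f' M.ν) (x : ℝ) :
    ∫ μ, ang g (fun y => f y + f' y) μ x ∂ρ =
      ∫ μ, ang g f' μ x ∂ρ + ∫ y, M.avgG ρ x y * f y ∂M.ν := by
  have h1 : ∀ μ, ang g (fun y => f y + f' y) μ x = ang g f' μ x + ∫ y, M.G μ x y * f y ∂M.ν := by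
    intro μ
    unfold ang
    simp only [mul_add]
    rw [integral_add (M.integrable_G_mul hf μ x) (M.integrable_G_mul hf' μ x)]
    ring
  simp only [h1]
  rw [integral_add (integrable_ang g ρ hf' x), integral_avgG_mul ρ hf x]
  have h2 : Integrable (fun μ => ang g (fun y => f y + f' y) μ x - ang g f' μ x) ρ :=
    (integrable_ang g ρ (hf.add hf') x).sub (integrable_ang g ρ hf' x)
  refine h2.congr (Filter.Eventually.of_forall fun μ => ?_)
  simp only [h1]
  ring

end Average

section Density

variable {c Q : ℝ → ℝ} {lam : ℝ}

lemma integrable_mul_add (hcm : Measurable c) (hc : ∀ᵐ y ∂M.ν, 0 ≤ c y ∧ c y ≤ lam)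
    (hQ : Integrable Q M.ν) {φ : ℝ → ℝ} (hφm : Measurable φ) {N : ℝ} (hφ : ∀ x, |φ x| ≤ N) :
    Integrable (fun y => c y * φ y) M.ν ∧ Integrable (fun y => c y * φ y + Q y) M.ν := by
  have h : Integrable (fun y => c y * φ y) M.ν := by
    refine Integrable.of_bound (hcm.mul hφm).aestronglyMeasurable (lam * N) ?_
    filter_upwards [hc] with y hy
    rw [Real.norm_eq_abs, abs_mul, abs_of_nonneg hy.1]
    exact mul_le_mul hy.2 (hφ y) (abs_nonneg _) (hy.1.trans hy.2)
  exact ⟨h, h.add hQ⟩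

/-- A bound of the densities, uniform in the scattering cross section and the quadrature. -/
def densityBound (g : M.Inflow) (Q : ℝ → ℝ) (lam : ℝ) : ℝ :=
  (g.bd + M.δ⁻¹ * ∫ y, |Q y| ∂M.ν) / (1 - lam)

lemma densityBound_num_nonneg (g : M.Inflow) (Q : ℝ → ℝ) :
    0 ≤ g.bd + M.δ⁻¹ * ∫ y, |Q y| ∂M.ν :=
  add_nonneg g.bd_nonneg (mul_nonneg (inv_nonneg.mpr M.δ_pos.le)
    (integral_nonneg fun _ => abs_nonneg _))

/-- Existence of the density, for a family of distributions `ρ p` of the velocity, measurably in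
the parameter `p`. -/
lemma exists_density {P : Type*} [MeasurableSpace P] (ρ : P → Measure ℝ)
    [∀ p, IsProbabilityMeasure (ρ p)]
    (hK : Measurable fun z : (P × ℝ) × ℝ => M.avgG (ρ z.1.1) z.1.2 z.2)
    (hb : Measurable fun z : P × ℝ => ∫ μ, ang g Q μ z.2 ∂(ρ z.1))
    (hcm : Measurable c) (hc : ∀ᵐ y ∂M.ν, 0 ≤ c y ∧ c y ≤ lam) (hlam : 0 ≤ lam) (hlam1 : lam < 1)
    (hQ : Integrable Q M.ν) :
    ∃ Φ : P → ℝ → ℝ, Measurable (Function.uncurry Φ) ∧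
      (∀ p x, |Φ p x| ≤ densityBound g Q lam) ∧
      ∀ p x, Φ p x = ∫ μ, ang g (fun y => c y * Φ p y + Q y) μ x ∂(ρ p) := by
  obtain ⟨Φ, h1, h2, h3⟩ := exists_measurable_solution (ν := M.ν) (K := fun p => M.avgG (ρ p))
    (b := fun p x => ∫ μ, ang g Q μ x ∂(ρ p)) hK (fun p => avgG_nonneg (ρ p))
    (fun p => integrable_avgG (ρ p)) (fun p => integral_avgG_le_one (ρ p)) hcm hc hlam hlam1 hb
    (fun p x => abs_integral_ang_le g (ρ p) hQ x) (densityBound_num_nonneg g Q)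
  refine ⟨Φ, h1, h2, fun p x => ?_⟩
  have hΦ : Measurable (Φ p) := h1.comp measurable_prodMk_left
  have h4 := integrable_mul_add hcm hc hQ hΦ (h2 p)
  rw [integral_ang_add g (ρ p) h4.1 hQ, h3 p x]

/-- Uniqueness of the density. Integrability of the total source is all that is needed of
the second solution. -/
lemma density_unique (ρ : Measure ℝ) [IsProbabilityMeasure ρ] (hcm : Measurable c)
    (hc : ∀ᵐ y ∂M.ν, 0 ≤ c y ∧ c y ≤ lam) (hlam : 0 ≤ lam) (hlam1 : lam < 1)
    (hQ : Integrable Q M.ν) {φ φ' : ℝ → ℝ} (hφm : Measurable φ) {N : ℝ} (hφN : ∀ x, |φ x| ≤ N)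
    (hφ : ∀ x ∈ M.I, φ x = ∫ μ, ang g (fun y => c y * φ y + Q y) μ x ∂ρ)
    (hf : Integrable (fun y => c y * φ' y + Q y) M.ν)
    (hφ' : ∀ x ∈ M.I, φ' x = ∫ μ, ang g (fun y => c y * φ' y + Q y) μ x ∂ρ) :
    ∀ x ∈ M.I, φ' x = φ x := by
  have h1 := integrable_mul_add hcm hc hQ hφm hφN
  have h2 : Integrable (fun y => c y * φ' y) M.ν := by
    refine (hf.sub hQ).congr (Filter.Eventually.of_forall fun y => ?_)
    simp
  have hbd : ∀ x ∈ M.I, |φ' x - φ x| ≤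
      (g.bd + M.δ⁻¹ * ∫ y, |c y * φ' y + Q y| ∂M.ν) + N := by
    intro x hx
    refine (abs_sub _ _).trans (add_le_add ?_ (hφN x))
    rw [hφ' x hx]
    exact abs_integral_ang_le g ρ hf x
  have h3 := abs_le_of_abs_defect_le (ν := M.ν) (I := M.I) (k := M.avgG ρ) (c := c)
    (d := fun x => φ' x - φ x) (lam := lam) (R := 0) (avgG_nonneg ρ) (integrable_avgG ρ)
    (integral_avgG_le_one ρ) M.ae_ν_mem hc hlam hlam1 hbd (fun x hx => ?_)
  · intro x hx
    have := h3 x hx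
    rw [zero_div] at this
    exact sub_eq_zero.mp (abs_nonpos_iff.mp this)
  · have e1 := hφ' x hx
    have e2 := hφ x hx
    rw [integral_ang_add g ρ h2 hQ] at e1
    rw [integral_ang_add g ρ h1.1 hQ] at e2
    have e3 : ∫ y, M.avgG ρ x y * (c y * (φ' y - φ y)) ∂M.ν =
        ∫ y, M.avgG ρ x y * (c y * φ' y) ∂M.ν - ∫ y, M.avgG ρ x y * (c y * φ y) ∂M.ν := by
      rw [← integral_sub (integrable_avgG_mul ρ h2 x) (integrable_avgG_mul ρ h1.1 x)]
      congr 1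
      ext y
      ring
    rw [e3]
    refine abs_nonpos_iff.mpr ?_
    linarith

end Density

end Slab

/-! ### The two distributions of the velocity -/

/-- The distribution of the velocity in the discrete system: the symmetric ordinates with their
weights. -/
def ordinateMeasure {m : ℕ} (δ : ℝ) (t : Fin (m + 1) → ℝ) (u : Fin m → ℝ) : Measure ℝ :=
  ∑ l, ENNReal.ofReal (weight δ t l) • Measure.dirac (symOrdinate u l)

namespace IsPartition

variable {m : ℕ} {δ : ℝ} {t : Fin (m + 1) → ℝ} (ht : IsPartition δ t)
include ht

lemma integral_ordinateMeasure (hδ0 : 0 < δ) (hδ1 : δ < 1) (u : Fin m → ℝ) (f : ℝ → ℝ) :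
    ∫ v, f v ∂(ordinateMeasure δ t u) = ordinateSum δ t u f := by
  unfold ordinateMeasure ordinateSum
  rw [integral_finsetSum_measure]
  · refine Finset.sum_congr rfl fun l _ => ?_
    rw [integral_smul_measure, integral_dirac, ENNReal.toReal_ofReal (ht.weight_nonneg hδ0 hδ1 l),
      smul_eq_mul]
  · intro l _
    exact (integrable_dirac (by simp)).smul_measure ENNReal.ofReal_ne_top

lemma sum_halfWeight (hδ1 : δ < 1) : ∑ l, halfWeight δ t l = 1 / 2 := by
  have h := ht.sum_integral_halfCell (locallyIntegrable_const (1 : ℝ))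
  simp only [intervalIntegral.integral_const, smul_eq_mul, mul_one] at h
  unfold halfWeight
  rw [← Finset.sum_div, h]
  have : 1 - δ ≠ 0 := by linarith
  field_simp
  ring

lemma isProbabilityMeasure_ordinateMeasure (hδ0 : 0 < δ) (hδ1 : δ < 1) (u : Fin m → ℝ) :
    IsProbabilityMeasure (ordinateMeasure δ t u) := by
  constructor
  unfold ordinateMeasure
  rw [Measure.finsetSum_apply]
  simp only [Measure.smul_apply, measure_univ, smul_eq_mul, mul_one]
  rw [← ENNReal.ofReal_sum_of_nonneg fun l _ => ht.weight_nonneg hδ0 hδ1 l, ENNReal.ofReal_eq_one]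
  have h := ht.ordinateSum_eq hδ0 hδ1 u (fun _ => 1)
  simp only [ordinateSum, mul_one] at h
  rw [h, ← Finset.sum_mul, ht.sum_halfWeight hδ1]
  norm_num

lemma symOrdinate_mem {u : Fin m → ℝ} (hu : ∀ l, u l ∈ halfCell t l) (l : Fin (m + m)) :
    symOrdinate u l ∈ velocitySpace δ := by
  refine Fin.addCases (fun l => ?_) (fun l => ?_) l
  · rw [symOrdinate, Fin.append_left]
    exact Or.inl (ht.halfCell_subset l (hu l))
  · rw [symOrdinate, Fin.append_right]
    have := ht.halfCell_subset _ (hu l.rev)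
    exact Or.inr ⟨by linarith [this.2], by linarith [this.1]⟩

end IsPartition

namespace Slab

variable (M : Slab)

/-- The uniform distribution on the truncated velocity space. -/
def unifS : Measure ℝ := volume[|M.S]

lemma volume_S : volume M.S = ENNReal.ofReal (2 * (1 - M.δ)) := by
  have h := volume_velocitySpace M.δ_pos M.δ_lt
  have hne : volume M.S ≠ ∞ := by
    refine (measure_mono (t := Set.Icc (-1) 1) fun v hv => ?_).trans_lt (by simp) |>.ne
    exact abs_le.mp (M.mem_S_iff.mp hv).2
  rw [← h]
  exact (ENNReal.ofReal_toReal hne).symm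

instance : IsProbabilityMeasure M.unifS := by
  refine cond_isProbabilityMeasure_of_finite ?_ ?_
  · rw [volume_S]
    have := M.δ_lt
    simpa using this
  · rw [volume_S]
    exact ENNReal.ofReal_ne_top

lemma setAverage_eq_integral_unifS (f : ℝ → ℝ) :
    ⨍ v in velocitySpace M.δ, f v = ∫ v, f v ∂M.unifS := by
  unfold unifS ProbabilityTheory.cond average
  rw [Measure.restrict_apply_univ]
  rfl

variable {M} (g : M.Inflow)

/-! ### Solutions of the continuous and of the discrete problem -/

section Solutions

variable {σS q ψL ψR : ℝ → ℝ}

lemma solvesTransport_ang {s f : ℝ → ℝ} {μ : ℝ} (hμ : μ ∈ M.S)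
    (hg : ∀ μ ∈ M.S, g.val μ = inflowData ψL ψR μ) (hf : Integrable f M.ν)
    (hsf : ∀ x ∈ M.I, s x = M.σT x * f x) :
    SolvesTransport M.xL M.xR M.σT s μ (inflowData ψL ψR μ) (fun x => ang g f μ x) := by
  rw [← hg μ hμ]
  exact M.solvesTransport_of_eq hμ hf hsf fun x _ => rfl

lemma eq_ang {s f ψ : ℝ → ℝ} {μ : ℝ} (hμ : μ ∈ M.S)
    (hg : ∀ μ ∈ M.S, g.val μ = inflowData ψL ψR μ)
    (h : SolvesTransport M.xL M.xR M.σT s μ (inflowData ψL ψR μ) ψ)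
    (hsf : ∀ x ∈ M.I, s x = M.σT x * f x) {x : ℝ} (hx : x ∈ M.I) : ψ x = ang g f μ x := by
  rw [← hg μ hμ] at h
  exact M.eq_att_add_integral hμ h hsf hx

lemma source_eq (φ : ℝ → ℝ) {x : ℝ} (hx : x ∈ M.I) :
    σS x * φ x + q x = M.σT x * (σS x / M.σT x * φ x + q x / M.σT x) := by
  have := (M.σT_pos hx).ne'
  field_simp

lemma integrable_of_solvesTransport {φ ψ : ℝ → ℝ} {μ b : ℝ}
    (h : SolvesTransport M.xL M.xR M.σT (fun x => σS x * φ x + q x) μ b ψ) :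
    Integrable (fun x => σS x / M.σT x * φ x + q x / M.σT x) M.ν := by
  rw [integrable_ν_iff]
  exact (M.integrableOn_source h).congr_fun (fun x hx => source_eq φ hx) M.measurableSet_I

/-- The density of a solution of the truncated transport equation solves the integral equation for
the uniform distribution of the velocity. -/
lemma avgDensity_eq (hg : ∀ μ ∈ M.S, g.val μ = inflowData ψL ψR μ) {ψ : ℝ → ℝ → ℝ}
    (h : SolvesRTE M.xL M.xR M.σT σS q ψL ψR M.δ ψ) :
    Integrable (fun x => σS x / M.σT x * avgDensity M.δ ψ x + q x / M.σT x) M.ν ∧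
    ∀ x ∈ M.I, avgDensity M.δ ψ x = ∫ μ, ang g
      (fun y => σS y / M.σT y * avgDensity M.δ ψ y + q y / M.σT y) μ x ∂M.unifS := by
  have h1 : (1 : ℝ) ∈ velocitySpace M.δ := Or.inr ⟨M.δ_lt, le_rfl⟩
  refine ⟨integrable_of_solvesTransport (h.2 1 h1), fun x hx => ?_⟩
  rw [← setAverage_eq_integral_unifS, avgDensity]
  refine setAverage_congr_fun M.measurableSet_S (Filter.Eventually.of_forall fun μ hμ => ?_)
  exact eq_ang g hμ hg (h.2 μ hμ) (fun x hx => source_eq _ hx) hx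

/-- A solution of the integral equation yields a solution of the truncated transport equation. -/
lemma solvesRTE_ang (hg : ∀ μ ∈ M.S, g.val μ = inflowData ψL ψR μ) {φ : ℝ → ℝ}
    (hf : Integrable (fun y => σS y / M.σT y * φ y + q y / M.σT y) M.ν)
    (hφ : ∀ x, φ x = ∫ μ, ang g (fun y => σS y / M.σT y * φ y + q y / M.σT y) μ x ∂M.unifS) :
    SolvesRTE M.xL M.xR M.σT σS q ψL ψR M.δ
      (fun x μ => ang g (fun y => σS y / M.σT y * φ y + q y / M.σT y) μ x) := by
  refine ⟨fun x _ => ?_, fun μ hμ => ?_⟩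
  · have hfin : IsFiniteMeasure (volume.restrict M.S) :=
      ⟨by rw [Measure.restrict_apply_univ, volume_S]; exact ENNReal.ofReal_lt_top⟩
    exact integrable_of_abs_le (μ := volume.restrict M.S) ((measurable_ang g hf).comp
      (measurable_id.prodMk measurable_const)).aestronglyMeasurable fun μ => abs_ang_le g hf μ x
  · refine solvesTransport_ang g hμ hg hf fun x hx => ?_
    rw [← source_eq φ hx, avgDensity, setAverage_eq_integral_unifS, ← hφ x]

variable {m : ℕ} {t : Fin (m + 1) → ℝ}

/-- The density of a solution of the discrete system solves the integral equation for the
distribution of the velocity given by the ordinates. -/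
lemma discreteDensity_eq (ht : IsPartition M.δ t) (hm : 0 < m)
    (hg : ∀ μ ∈ M.S, g.val μ = inflowData ψL ψR μ) {u : Fin m → ℝ}
    (hu : ∀ l, u l ∈ halfCell t l) {ψ : Fin (m + m) → ℝ → ℝ}
    (h : SolvesROM M.xL M.xR M.σT σS q ψL ψR M.δ t u ψ) :
    Integrable (fun x => σS x / M.σT x * discreteDensity M.δ t ψ x + q x / M.σT x) M.ν ∧
    ∀ x ∈ M.I, discreteDensity M.δ t ψ x = ∫ μ, ang g
      (fun y => σS y / M.σT y * discreteDensity M.δ t ψ y + q y / M.σT y) μ x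
        ∂(ordinateMeasure M.δ t u) := by
  refine ⟨integrable_of_solvesTransport (h ⟨0, by omega⟩), fun x hx => ?_⟩
  rw [ht.integral_ordinateMeasure M.δ_pos M.δ_lt, ordinateSum]
  refine Finset.sum_congr rfl fun l _ => ?_
  rw [eq_ang g (ht.symOrdinate_mem hu l) hg (h l) (fun x hx => source_eq _ hx) hx]

/-- A solution of the integral equation yields a solution of the discrete system. -/
lemma solvesROM_ang (ht : IsPartition M.δ t) (hg : ∀ μ ∈ M.S, g.val μ = inflowData ψL ψR μ)
    {u : Fin m → ℝ} (hu : ∀ l, u l ∈ halfCell t l) {φ : ℝ → ℝ}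
    (hf : Integrable (fun y => σS y / M.σT y * φ y + q y / M.σT y) M.ν)
    (hφ : ∀ x, φ x = ∫ μ, ang g (fun y => σS y / M.σT y * φ y + q y / M.σT y) μ x
      ∂(ordinateMeasure M.δ t u)) :
    SolvesROM M.xL M.xR M.σT σS q ψL ψR M.δ t u
      (fun l x => ang g (fun y => σS y / M.σT y * φ y + q y / M.σT y) (symOrdinate u l) x) := by
  intro l
  refine solvesTransport_ang g (ht.symOrdinate_mem hu l) hg hf fun x hx => ?_
  rw [← source_eq φ hx]
  congr 2
  rw [hφ x, ht.integral_ordinateMeasure M.δ_pos M.δ_lt]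
  rfl

end Solutions

end Slab

lemma measurable_symOrdinate {m : ℕ} (l : Fin (m + m)) :
    Measurable fun u : Fin m → ℝ => symOrdinate u l := by
  refine Fin.addCases (fun l => ?_) (fun l => ?_) l
  · simp only [symOrdinate, Fin.append_left]
    exact measurable_pi_apply l
  · simp only [symOrdinate, Fin.append_right]
    exact (measurable_pi_apply _).neg

lemma measurable_ordinateSum {m : ℕ} {δ : ℝ} {t : Fin (m + 1) → ℝ} {α : Type*} [MeasurableSpace α]
    {F : ℝ × α → ℝ} (hF : Measurable F) :
    Measurable fun z : (Fin m → ℝ) × α => ordinateSum δ t z.1 (fun μ => F (μ, z.2)) := by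
  unfold ordinateSum
  refine Finset.measurable_sum _ fun l _ => Measurable.const_mul ?_ _
  exact hF.comp (((measurable_symOrdinate l).comp measurable_fst).prodMk measurable_snd)

namespace Slab

variable {M : Slab} (g : M.Inflow)

/-! ### Mean square error and bias of the random density -/

section Error

variable {c Q : ℝ → ℝ} {lam₀ : ℝ} {m : ℕ} {t : Fin (m + 1) → ℝ}

lemma measurable_avgG_ordinateMeasure (ht : IsPartition M.δ t) :
    Measurable fun z : ((Fin m → ℝ) × ℝ) × ℝ =>
      M.avgG (ordinateMeasure M.δ t z.1.1) z.1.2 z.2 := by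
  unfold avgG
  simp only [ht.integral_ordinateMeasure M.δ_pos M.δ_lt]
  have h := measurable_ordinateSum (δ := M.δ) (t := t) M.measurable_G
  exact h.comp (measurable_fst.fst.prodMk (measurable_fst.snd.prodMk measurable_snd))

lemma measurable_integral_ang_ordinateMeasure (ht : IsPartition M.δ t) {f : ℝ → ℝ}
    (hf : Integrable f M.ν) :
    Measurable fun z : (Fin m → ℝ) × ℝ =>
      ∫ μ, ang g f μ z.2 ∂(ordinateMeasure M.δ t z.1) := by
  simp only [ht.integral_ordinateMeasure M.δ_pos M.δ_lt]
  exact measurable_ordinateSum (measurable_ang g hf)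

/-- A bound of the total sources, uniform in the scattering cross section. -/
def sourceBound (g : M.Inflow) (Q : ℝ → ℝ) (lam₀ : ℝ) : ℝ :=
  densityBound g Q lam₀ * M.ν.real Set.univ + ∫ y, |Q y| ∂M.ν

/-- A Lipschitz constant in the velocity, on each half of the velocity space, of the solution of the
truncated transport equation, uniform in the scattering cross section. -/
def lipAng (g : M.Inflow) (Q : ℝ → ℝ) (lam₀ : ℝ) : ℝ :=
  g.lip + g.bd * (M.depth * (M.δ⁻¹) ^ 2) + M.lipG * sourceBound g Q lam₀

lemma densityBound_nonneg (g : M.Inflow) (Q : ℝ → ℝ) (hlam1 : lam₀ < 1) :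
    0 ≤ densityBound g Q lam₀ :=
  div_nonneg (densityBound_num_nonneg g Q) (by linarith)

lemma sourceBound_nonneg (g : M.Inflow) (Q : ℝ → ℝ) (hlam1 : lam₀ < 1) :
    0 ≤ sourceBound g Q lam₀ :=
  add_nonneg (mul_nonneg (densityBound_nonneg g Q hlam1) measureReal_nonneg)
    (integral_nonneg fun _ => abs_nonneg _)

lemma lipAng_nonneg (g : M.Inflow) (Q : ℝ → ℝ) (hlam1 : lam₀ < 1) : 0 ≤ lipAng g Q lam₀ := by
  have h1 := g.lip_nonneg
  have h2 := g.bd_nonneg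
  have h3 := M.depth_nonneg
  have h4 := M.lipG_nonneg
  have h5 := sourceBound_nonneg g Q hlam1
  unfold lipAng
  positivity

/-- The constant in the mean square error of the density. -/
def mseConst (g : M.Inflow) (Q : ℝ → ℝ) (lam₀ A : ℝ) : ℝ :=
  ((1 - lam₀) ^ 2)⁻¹ * (M.ν.real Set.univ * (8 * A ^ 4 * lipAng g Q lam₀ ^ 2))

/-- The constant in the bias of the density. -/
def biasConst (g : M.Inflow) (Q : ℝ → ℝ) (lam₀ A : ℝ) : ℝ :=
  (M.ν.real Set.univ * (8 * A ^ 4 * M.lipG ^ 2) + mseConst g Q lam₀ A) / 2 / (1 - lam₀)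

variable (hcm : Measurable c) (hc : ∀ᵐ y ∂M.ν, 0 ≤ c y ∧ c y ≤ lam₀) (hlam0 : 0 < lam₀)
  (hlam1 : lam₀ < 1) (hQ : Integrable Q M.ν)
  {φ : ℝ → ℝ} (hφm : Measurable φ) (hφB : ∀ x, |φ x| ≤ densityBound g Q lam₀)
  (hφ : ∀ x, φ x = ∫ μ, ang g (fun y => c y * φ y + Q y) μ x ∂M.unifS)

include hcm hc hlam1 hQ hφm hφB in
lemma integral_abs_source_le :
    ∫ y, |c y * φ y + Q y| ∂M.ν ≤ sourceBound g Q lam₀ := by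
  have h1 := integrable_mul_add hcm hc hQ hφm hφB
  calc ∫ y, |c y * φ y + Q y| ∂M.ν ≤ ∫ y, (densityBound g Q lam₀ + |Q y|) ∂M.ν := by
        refine integral_mono_ae h1.2.abs ((integrable_const _).add hQ.abs) ?_
        filter_upwards [hc] with y hy
        refine (abs_add_le _ _).trans (by
          gcongr
          rw [abs_mul, abs_of_nonneg hy.1]
          exact (mul_le_mul (hy.2.trans hlam1.le) (hφB y) (abs_nonneg _) zero_le_one).trans
            (one_mul _).le)
    _ = sourceBound g Q lam₀ := by
        rw [integral_add (integrable_const _) hQ.abs, integral_const, smul_eq_mul, mul_comm]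
        rfl

variable (ht : IsPartition M.δ t) {Φ : (Fin m → ℝ) → ℝ → ℝ}
  (hΦm : Measurable (Function.uncurry Φ)) (hΦB : ∀ u x, |Φ u x| ≤ densityBound g Q lam₀)
  (hΦ : ∀ u x, Φ u x = ∫ μ, ang g (fun y => c y * Φ u y + Q y) μ x ∂(ordinateMeasure M.δ t u))

include hcm hc hQ hφm hφB hφ ht hΦm hΦB hΦ in
/-- The equation for the error of the density: its source is the sampling error of the exact
solution. -/
lemma error_eq (u : Fin m → ℝ) (x : ℝ) :
    Φ u x - φ x = ∫ y, M.avgG (ordinateMeasure M.δ t u) x y * (c y * (Φ u y - φ y)) ∂M.ν +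
      (ordinateSum M.δ t u (fun μ => ang g (fun y => c y * φ y + Q y) μ x) -
        ⨍ μ in velocitySpace M.δ, ang g (fun y => c y * φ y + Q y) μ x) := by
  have := ht.isProbabilityMeasure_ordinateMeasure M.δ_pos M.δ_lt u
  have h1 := integrable_mul_add hcm hc hQ hφm hφB
  have hΦu : Measurable (Φ u) := hΦm.comp measurable_prodMk_left
  have h2 := integrable_mul_add hcm hc hQ hΦu (hΦB u)
  rw [setAverage_eq_integral_unifS, ← hφ x, ← ht.integral_ordinateMeasure M.δ_pos M.δ_lt,
    integral_ang_add g _ h1.1 hQ]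
  have e1 := hΦ u x
  rw [integral_ang_add g _ h2.1 hQ] at e1
  have e3 : ∫ y, M.avgG (ordinateMeasure M.δ t u) x y * (c y * (Φ u y - φ y)) ∂M.ν =
      ∫ y, M.avgG (ordinateMeasure M.δ t u) x y * (c y * Φ u y) ∂M.ν -
        ∫ y, M.avgG (ordinateMeasure M.δ t u) x y * (c y * φ y) ∂M.ν := by
    rw [← integral_sub (integrable_avgG_mul _ h2.1 x) (integrable_avgG_mul _ h1.1 x)]
    congr 1
    ext y
    ring
  rw [e3]
  linarith

include hφB hΦB in
lemma abs_error_le (u : Fin m → ℝ) (x : ℝ) : |Φ u x - φ x| ≤ 2 * densityBound g Q lam₀ := by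
  have h1 := abs_sub (Φ u x) (φ x)
  have h2 := hΦB u x
  have h3 := hφB x
  linarith

variable {Ω : Type*} [MeasurableSpace Ω] {P : Measure Ω} [IsProbabilityMeasure P]
  {U : Fin m → Ω → ℝ} {A : ℝ} (hm : 0 < m) (hA : ∀ l, rescaledWeight M.δ t l ≤ A)
  (hUm : ∀ l, Measurable (U l)) (hind : iIndepFun U P)
  (hU : ∀ l, pdf.IsUniform (U l) (halfCell t l) P volume)

include hφm hΦm hUm in
omit [IsProbabilityMeasure P] in
lemma measurable_error : Measurable fun z : Ω × ℝ => Φ (fun l => U l z.1) z.2 - φ z.2 := by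
  have h1 : Measurable fun z : Ω × ℝ => ((fun l => U l z.1 : Fin m → ℝ), z.2) :=
    (measurable_pi_lambda _ fun l => (hUm l).comp measurable_fst).prodMk measurable_snd
  exact (hΦm.comp h1).sub (hφm.comp measurable_snd)

include hφm hφB hΦm hΦB hUm in
lemma integrable_error_sq :
    Integrable (fun z : Ω × ℝ => (Φ (fun l => U l z.1) z.2 - φ z.2) ^ 2) (P.prod M.ν) :=
  integrable_of_abs_le ((measurable_error hφm hΦm hUm).pow_const 2).aestronglyMeasurable
    (B := (2 * densityBound g Q lam₀) ^ 2) fun z => by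
      rw [abs_pow]
      have := abs_error_le g hφB hΦB (fun l => U l z.1) z.2
      gcongr

include hcm hc hlam0 hlam1 hQ hφm hφB hφ ht hΦm hΦB hΦ hm hA hUm hind hU in
/-- The mean square error of the random density is of order `n⁻³`. -/
theorem integral_integral_error_sq_le :
    ∫ ω, ∫ x, (Φ (fun l => U l ω) x - φ x) ^ 2 ∂M.ν ∂P ≤
      mseConst g Q lam₀ A / ((m + m : ℕ) : ℝ) ^ 3 := by
  set f : ℝ → ℝ := fun y => c y * φ y + Q y with hf_def
  have hf : Integrable f M.ν := (integrable_mul_add hcm hc hQ hφm hφB).2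
  set r : (Fin m → ℝ) → ℝ → ℝ := fun u x => ordinateSum M.δ t u (fun μ => ang g f μ x) -
    ⨍ μ in velocitySpace M.δ, ang g f μ x with hr_def
  have hrm : Measurable (Function.uncurry r) := by
    have h1 := measurable_ordinateSum (δ := M.δ) (t := t) (measurable_ang g hf)
    have h2 : Measurable fun x : ℝ => ⨍ μ in velocitySpace M.δ, ang g f μ x := by
      have h3 : (fun x : ℝ => ⨍ μ in velocitySpace M.δ, ang g f μ x) = φ := by
        ext x
        rw [setAverage_eq_integral_unifS, hφ x]
      rwa [h3]
    exact h1.sub (h2.comp measurable_snd)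
  have hrB : ∀ u x, |r u x| ≤ 2 * (g.bd + M.δ⁻¹ * ∫ y, |f y| ∂M.ν) := by
    intro u x
    have := ht.isProbabilityMeasure_ordinateMeasure M.δ_pos M.δ_lt u
    have h1 := abs_integral_ang_le g (ordinateMeasure M.δ t u) hf x
    have h2 := abs_integral_ang_le g M.unifS hf x
    simp only [hr_def]
    rw [setAverage_eq_integral_unifS, ← ht.integral_ordinateMeasure M.δ_pos M.δ_lt]
    have h3 := abs_sub (∫ μ, ang g f μ x ∂(ordinateMeasure M.δ t u)) (∫ μ, ang g f μ x ∂M.unifS)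
    linarith
  have hUz : Measurable fun z : Ω × ℝ => ((fun l => U l z.1 : Fin m → ℝ), z.2) :=
    (measurable_pi_lambda _ fun l => (hUm l).comp measurable_fst).prodMk measurable_snd
  have hrU : Measurable fun z : Ω × ℝ => r (fun l => U l z.1) z.2 := by
    have h1 := hrm.comp hUz
    exact h1
  have hrI : Integrable (fun z : Ω × ℝ => r (fun l => U l z.1) z.2 ^ 2) (P.prod M.ν) :=
    integrable_of_abs_le (hrU.pow_const 2).aestronglyMeasurable
      (B := (2 * (g.bd + M.δ⁻¹ * ∫ y, |f y| ∂M.ν)) ^ 2) fun z => by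
        rw [abs_pow]
        have := hrB (fun l => U l z.1) z.2
        gcongr
  -- the stability estimate, for each realization
  have hstab : ∀ u, ∫ x, (Φ u x - φ x) ^ 2 ∂M.ν ≤ ((1 - lam₀) ^ 2)⁻¹ * ∫ x, r u x ^ 2 ∂M.ν := by
    intro u
    have := ht.isProbabilityMeasure_ordinateMeasure M.δ_pos M.δ_lt u
    have hΦu : Measurable (Φ u) := hΦm.comp measurable_prodMk_left
    have hru : Measurable (r u) := hrm.of_uncurry_left
    have herr : ∀ x, Φ u x - φ x =
        ∫ y, M.avgG (ordinateMeasure M.δ t u) x y * (c y * (Φ u y - φ y)) ∂M.ν + r u x :=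
      error_eq g hcm hc hQ hφm hφB hφ ht hΦm hΦB hΦ u
    have hruI : Integrable (fun x => r u x ^ 2) M.ν :=
      integrable_of_abs_le (hru.pow_const 2).aestronglyMeasurable
        (B := (2 * (g.bd + M.δ⁻¹ * ∫ y, |f y| ∂M.ν)) ^ 2) fun x => by
          rw [abs_pow]
          have := hrB u x
          gcongr
    exact integral_sq_le_of_eq_add (k := M.avgG (ordinateMeasure M.δ t u)) (r := r u)
      (e := fun x => Φ u x - φ x) (measurable_avgG _) (avgG_nonneg _)
      (avgG_le _) (integral_avgG_le_one _) (integral_avgG_le_one' _) hc hlam0 hlam1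
      (hΦu.sub hφm).aestronglyMeasurable
      (Filter.Eventually.of_forall (abs_error_le g hφB hΦB u)) hruI
      (Filter.Eventually.of_forall herr)
  -- the variance estimate, at each point of the slab
  have hvar : ∀ x, ∫ ω, r (fun l => U l ω) x ^ 2 ∂P ≤
      8 * A ^ 4 * lipAng g Q lam₀ ^ 2 / ((m + m : ℕ) : ℝ) ^ 3 := by
    intro x
    have h1 : Measurable fun μ => ang g f μ x :=
      (measurable_ang g hf).comp (measurable_id.prodMk measurable_const)
    refine integral_sq_ordinateSum_sub_le M.δ_pos M.δ_lt ht hm hA hUm hind hU h1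
      (fun μ => abs_ang_le g hf μ x) (lipAng_nonneg g Q hlam1) fun v hv w hw hvw => ?_
    refine (abs_ang_sub_le g hf hv hw hvw x).trans ?_
    have h2 := integral_abs_source_le g hcm hc hlam1 hQ hφm hφB
    have h3 := M.lipG_nonneg
    unfold lipAng
    gcongr
  have h1 : 0 < 1 - lam₀ := by linarith
  calc ∫ ω, ∫ x, (Φ (fun l => U l ω) x - φ x) ^ 2 ∂M.ν ∂P
      ≤ ∫ ω, ((1 - lam₀) ^ 2)⁻¹ * ∫ x, r (fun l => U l ω) x ^ 2 ∂M.ν ∂P :=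
        integral_mono (integrable_error_sq g hφm hφB hΦm hΦB hUm).integral_prod_left
          (hrI.integral_prod_left.const_mul _) fun ω => hstab _
    _ = ((1 - lam₀) ^ 2)⁻¹ * ∫ x, ∫ ω, r (fun l => U l ω) x ^ 2 ∂P ∂M.ν := by
        rw [integral_const_mul, integral_integral_swap hrI]
    _ ≤ ((1 - lam₀) ^ 2)⁻¹ *
          ∫ _x, 8 * A ^ 4 * lipAng g Q lam₀ ^ 2 / ((m + m : ℕ) : ℝ) ^ 3 ∂M.ν := by
        have h2 : 0 ≤ ((1 - lam₀) ^ 2)⁻¹ := by positivity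
        exact mul_le_mul_of_nonneg_left
          (integral_mono hrI.integral_prod_right (integrable_const _) hvar) h2
    _ = mseConst g Q lam₀ A / ((m + m : ℕ) : ℝ) ^ 3 := by
        rw [integral_const, smul_eq_mul]
        unfold mseConst
        ring

include hcm hc hlam0 hlam1 hQ hφm hφB hφ ht hΦm hΦB hΦ hm hA hUm hind hU in
/-- The bias of the random density is of order `n⁻³`: the first-order term of its expansion has mean
zero, and what remains is the correlation of the sampling error of the kernel with the error of
the density. -/
theorem abs_integral_error_le {lam : ℝ} (hlam : 0 ≤ lam) (hc' : ∀ᵐ y ∂M.ν, c y ≤ lam) (x : ℝ) :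
    |∫ ω, (Φ (fun l => U l ω) x - φ x) ∂P| ≤
      lam * biasConst g Q lam₀ A / ((m + m : ℕ) : ℝ) ^ 3 := by
  set n : ℝ := ((m + m : ℕ) : ℝ) with hn
  set f : ℝ → ℝ := fun y => c y * φ y + Q y with hf_def
  have hf : Integrable f M.ν := (integrable_mul_add hcm hc hQ hφm hφB).2
  set e : Ω → ℝ → ℝ := fun ω x => Φ (fun l => U l ω) x - φ x with he_def
  have hem : Measurable (Function.uncurry e) := measurable_error hφm hΦm hUm
  have heB : ∀ ω x, |e ω x| ≤ 2 * densityBound g Q lam₀ := fun ω x => abs_error_le g hφB hΦB _ x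
  have heI : ∀ x, Integrable (fun ω => e ω x) P := fun x =>
    integrable_of_abs_le (hem.comp (measurable_id.prodMk measurable_const)).aestronglyMeasurable
      fun ω => heB ω x
  have hmse : ∫ ω, ∫ y, e ω y ^ 2 ∂M.ν ∂P ≤ mseConst g Q lam₀ A / n ^ 3 :=
    integral_integral_error_sq_le g hcm hc hlam0 hlam1 hQ hφm hφB hφ ht hΦm hΦB hΦ hm hA hUm hind hU
  have heSq : Integrable (fun z : Ω × ℝ => e z.1 z.2 ^ 2) (P.prod M.ν) :=
    integrable_error_sq g hφm hφB hΦm hΦB hUm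
  -- the sampling error of the kernel
  set K : Ω → ℝ → ℝ → ℝ := fun ω => M.avgG (ordinateMeasure M.δ t (fun l => U l ω)) with hK_def
  have hprob : ∀ ω, IsProbabilityMeasure (ordinateMeasure M.δ t (fun l => U l ω)) := fun ω =>
    ht.isProbabilityMeasure_ordinateMeasure M.δ_pos M.δ_lt _
  set D : ℝ → Ω → ℝ → ℝ := fun x ω y => K ω x y - M.avgG M.unifS x y with hD_def
  have hKm : ∀ x, Measurable fun z : Ω × ℝ => K z.1 x z.2 := by
    intro x
    have h1 : Measurable fun z : Ω × ℝ => (((fun l => U l z.1 : Fin m → ℝ), x), z.2) :=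
      ((measurable_pi_lambda _ fun l => (hUm l).comp measurable_fst).prodMk
        measurable_const).prodMk measurable_snd
    have h2 := (measurable_avgG_ordinateMeasure ht).comp h1
    exact h2
  have hK0m : ∀ x, Measurable fun z : Ω × ℝ => M.avgG M.unifS x z.2 := fun x =>
    ((measurable_avgG M.unifS).comp measurable_prodMk_left).comp measurable_snd
  have hKB : ∀ ω x y, |K ω x y| ≤ M.δ⁻¹ := fun ω x y => by
    rw [abs_of_nonneg (avgG_nonneg _ x y)]
    have := hprob ω
    exact avgG_le _ x y
  have hK0B : ∀ x y, |M.avgG M.unifS x y| ≤ M.δ⁻¹ := fun x y => by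
    rw [abs_of_nonneg (avgG_nonneg _ x y)]
    exact avgG_le _ x y
  have hDB : ∀ x ω y, |D x ω y| ≤ 2 * M.δ⁻¹ := fun x ω y => by
    have h1 := abs_sub (K ω x y) (M.avgG M.unifS x y)
    have h2 := hKB ω x y
    have h3 := hK0B x y
    simp only [hD_def]
    linarith
  have hDSq : ∀ x, Integrable (fun z : Ω × ℝ => D x z.1 z.2 ^ 2) (P.prod M.ν) := fun x =>
    integrable_of_abs_le (((hKm x).sub (hK0m x)).pow_const 2).aestronglyMeasurable
      (B := (2 * M.δ⁻¹) ^ 2) fun z => by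
        rw [abs_pow]
        have := hDB x z.1 z.2
        gcongr
  have hDvar : ∀ x y, ∫ ω, D x ω y ^ 2 ∂P ≤ 8 * A ^ 4 * M.lipG ^ 2 / n ^ 3 := by
    intro x y
    have h1 : Measurable fun μ => M.G μ x y :=
      M.measurable_G_comp measurable_id measurable_const measurable_const
    have h2 := integral_sq_ordinateSum_sub_le M.δ_pos M.δ_lt ht hm hA hUm hind hU h1
      (fun μ => M.abs_G_le μ x y) M.lipG_nonneg fun v hv w hw hvw =>
        M.abs_G_sub_le hv hw hvw x y
    simp only [hD_def, hK_def, avgG]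
    simp only [ht.integral_ordinateMeasure M.δ_pos M.δ_lt]
    rw [← setAverage_eq_integral_unifS]
    exact h2
  have hDint : ∀ x, ∫ ω, ∫ y, D x ω y ^ 2 ∂M.ν ∂P ≤
      M.ν.real Set.univ * (8 * A ^ 4 * M.lipG ^ 2) / n ^ 3 := by
    intro x
    rw [integral_integral_swap (hDSq x)]
    calc ∫ y, ∫ ω, D x ω y ^ 2 ∂P ∂M.ν ≤ ∫ _y, 8 * A ^ 4 * M.lipG ^ 2 / n ^ 3 ∂M.ν :=
          integral_mono (hDSq x).integral_prod_right (integrable_const _) (hDvar x)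
      _ = _ := by
          rw [integral_const, smul_eq_mul]
          ring
  -- integrability of the products that occur in the equation of the error
  have hce : Integrable (fun z : Ω × ℝ => c z.2 * e z.1 z.2) (P.prod M.ν) := by
    have h1 : ∀ᵐ z ∂(P.prod M.ν), 0 ≤ c z.2 ∧ c z.2 ≤ lam₀ :=
      Measure.quasiMeasurePreserving_snd.ae hc
    refine Integrable.of_bound ((hcm.comp measurable_snd).mul hem).aestronglyMeasurable
      (lam₀ * (2 * densityBound g Q lam₀)) ?_
    filter_upwards [h1] with z hz
    rw [Real.norm_eq_abs, abs_mul, abs_of_nonneg hz.1]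
    exact mul_le_mul hz.2 (heB _ _) (abs_nonneg _) hlam0.le
  have hce' : ∀ ω, Integrable (fun y => c y * e ω y) M.ν := by
    intro ω
    refine Integrable.of_bound (hcm.mul (hem.comp measurable_prodMk_left)).aestronglyMeasurable
      (lam₀ * (2 * densityBound g Q lam₀)) ?_
    filter_upwards [hc] with y hy
    rw [Real.norm_eq_abs, abs_mul, abs_of_nonneg hy.1]
    exact mul_le_mul hy.2 (heB _ _) (abs_nonneg _) hlam0.le
  have hKce : ∀ x, Integrable (fun z : Ω × ℝ => K z.1 x z.2 * (c z.2 * e z.1 z.2))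
      (P.prod M.ν) := fun x =>
    hce.bdd_mul (hKm x).aestronglyMeasurable (Filter.Eventually.of_forall fun z => hKB z.1 x z.2)
  have hK0ce : ∀ x, Integrable (fun z : Ω × ℝ => M.avgG M.unifS x z.2 * (c z.2 * e z.1 z.2))
      (P.prod M.ν) := fun x =>
    hce.bdd_mul (hK0m x).aestronglyMeasurable (Filter.Eventually.of_forall fun z => hK0B x z.2)
  have hKceI : ∀ x, Integrable (fun ω => ∫ y, K ω x y * (c y * e ω y) ∂M.ν) P := fun x =>
    (hKce x).integral_prod_left
  have hK0ceI : ∀ x, Integrable (fun ω => ∫ y, M.avgG M.unifS x y * (c y * e ω y) ∂M.ν) P :=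
    fun x => (hK0ce x).integral_prod_left
  set E : ℝ → ℝ := fun x => ∫ ω, e ω x ∂P with hE_def
  -- the expected error solves the averaged equation up to a correlation term
  have hEeq : ∀ x, E x - ∫ y, M.avgG M.unifS x y * (c y * E y) ∂M.ν =
      ∫ ω, ∫ y, D x ω y * (c y * e ω y) ∂M.ν ∂P := by
    intro x
    have h1 : Measurable fun μ => ang g f μ x :=
      (measurable_ang g hf).comp (measurable_id.prodMk measurable_const)
    have h2 := integral_ordinateSum M.δ_pos M.δ_lt ht hUm hU h1 (fun μ => abs_ang_le g hf μ x)
    have h3 : ∀ ω, e ω x = ∫ y, K ω x y * (c y * e ω y) ∂M.ν +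
        (ordinateSum M.δ t (fun l => U l ω) (fun μ => ang g f μ x) -
          ⨍ μ in velocitySpace M.δ, ang g f μ x) := fun ω =>
      error_eq g hcm hc hQ hφm hφB hφ ht hΦm hΦB hΦ _ x
    have h4 : Integrable
        (fun ω => ordinateSum M.δ t (fun l => U l ω) (fun μ => ang g f μ x)) P := by
      have h5 : Integrable (fun ω => e ω x - ∫ y, K ω x y * (c y * e ω y) ∂M.ν +
          ⨍ μ in velocitySpace M.δ, ang g f μ x) P :=
        ((heI x).sub (hKce x).integral_prod_left).add (integrable_const _)
      refine h5.congr (Filter.Eventually.of_forall fun ω => ?_)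
      have := h3 ω
      simp only
      linarith
    have h6 : E x = ∫ ω, ∫ y, K ω x y * (c y * e ω y) ∂M.ν ∂P := by
      simp only [hE_def]
      rw [integral_congr_ae (Filter.Eventually.of_forall h3),
        integral_add (g := fun ω => ordinateSum M.δ t (fun l => U l ω) (fun μ => ang g f μ x) -
          ⨍ μ in velocitySpace M.δ, ang g f μ x) (hKceI x) (h4.sub (integrable_const _)),
        integral_sub h4 (integrable_const _), h2, integral_const]
      simp
    have h7 : ∫ y, M.avgG M.unifS x y * (c y * E y) ∂M.ν =
        ∫ ω, ∫ y, M.avgG M.unifS x y * (c y * e ω y) ∂M.ν ∂P := by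
      rw [integral_integral_swap (hK0ce x)]
      simp only [integral_const_mul, hE_def]
    rw [h6, h7, ← integral_sub (hKceI x) (hK0ceI x)]
    congr 1
    ext ω
    have := hprob ω
    simp only [hK_def]
    rw [← integral_sub (integrable_avgG_mul _ (hce' ω) x) (integrable_avgG_mul _ (hce' ω) x)]
    congr 1
    ext y
    simp only [hD_def]
    ring
  have hcorr : ∀ x, |∫ ω, ∫ y, D x ω y * (c y * e ω y) ∂M.ν ∂P| ≤
      lam * ((M.ν.real Set.univ * (8 * A ^ 4 * M.lipG ^ 2) + mseConst g Q lam₀ A) / 2) / n ^ 3 := by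
    intro x
    have hsumI : Integrable (fun z : Ω × ℝ => D x z.1 z.2 ^ 2 + e z.1 z.2 ^ 2) (P.prod M.ν) :=
      (hDSq x).add heSq
    have hinner : ∀ᵐ ω ∂P, ‖∫ y, D x ω y * (c y * e ω y) ∂M.ν‖ ≤
        lam / 2 * ∫ y, (D x ω y ^ 2 + e ω y ^ 2) ∂M.ν := by
      filter_upwards [hsumI.prod_right_ae] with ω hω
      rw [← integral_const_mul]
      refine norm_integral_le_of_norm_le (hω.const_mul _) ?_
      filter_upwards [hc, hc'] with y hy hy'
      rw [Real.norm_eq_abs, abs_mul, abs_mul, abs_of_nonneg hy.1]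
      have h1 : 0 ≤ |D x ω y| * |e ω y| := by positivity
      have h2 : c y * (|D x ω y| * |e ω y|) ≤ lam * (|D x ω y| * |e ω y|) :=
        mul_le_mul_of_nonneg_right hy' h1
      have h3 : 2 * (|D x ω y| * |e ω y|) ≤ D x ω y ^ 2 + e ω y ^ 2 := by
        rw [← sq_abs (D x ω y), ← sq_abs (e ω y)]
        nlinarith [sq_nonneg (|D x ω y| - |e ω y|)]
      nlinarith [mul_le_mul_of_nonneg_left h3 hlam]
    calc |∫ ω, ∫ y, D x ω y * (c y * e ω y) ∂M.ν ∂P|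
        ≤ ∫ ω, lam / 2 * ∫ y, (D x ω y ^ 2 + e ω y ^ 2) ∂M.ν ∂P :=
          norm_integral_le_of_norm_le (hsumI.integral_prod_left.const_mul _) hinner
      _ = lam / 2 * (∫ ω, ∫ y, D x ω y ^ 2 ∂M.ν ∂P + ∫ ω, ∫ y, e ω y ^ 2 ∂M.ν ∂P) := by
          rw [integral_const_mul,
            ← integral_add (hDSq x).integral_prod_left heSq.integral_prod_left]
          congr 1
          refine integral_congr_ae ?_
          filter_upwards [(hDSq x).prod_right_ae, heSq.prod_right_ae] with ω h1 h2
          exact integral_add h1 h2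
      _ ≤ lam / 2 * (M.ν.real Set.univ * (8 * A ^ 4 * M.lipG ^ 2) / n ^ 3 +
            mseConst g Q lam₀ A / n ^ 3) := by
          have := hDint x
          gcongr
      _ = _ := by ring
  have hEB : ∀ x ∈ Set.univ, |E x| ≤ 2 * densityBound g Q lam₀ := by
    intro x _
    have h1 := norm_integral_le_of_norm_le (f := fun ω => e ω x) (integrable_const (μ := P)
      (2 * densityBound g Q lam₀)) (Filter.Eventually.of_forall fun ω => heB ω x)
    simpa using h1
  have h := abs_le_of_abs_defect_le (ν := M.ν) (I := Set.univ) (k := M.avgG M.unifS) (c := c)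
    (d := E) (avgG_nonneg _) (integrable_avgG _) (integral_avgG_le_one _) (by simp) hc hlam0.le
    hlam1 hEB (fun x _ => by rw [hEeq x]; exact hcorr x) x (Set.mem_univ x)
  refine h.trans (le_of_eq ?_)
  unfold biasConst
  have : 1 - lam₀ ≠ 0 := by linarith
  field_simp

end Error

end Slab

/-! ### From the data of the problem to the two error estimates -/

lemma eLpNorm_two_eq_ofReal_sqrt {α : Type*} [MeasurableSpace α] {μ : Measure α} {f : α → ℝ}
    (hf : MemLp f 2 μ) : eLpNorm f 2 μ = ENNReal.ofReal √(∫ x, f x ^ 2 ∂μ) := by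
  rw [hf.eLpNorm_eq_integral_rpow_norm (by norm_num) (by norm_num), Real.sqrt_eq_rpow]
  simp

/-- The expected square root of a random variable whose mean is at most `C * s ^ 2`. -/
lemma lintegral_ofReal_sqrt_le {Ω : Type*} [MeasurableSpace Ω] {P : Measure Ω}
    [IsProbabilityMeasure P] {X : Ω → ℝ} (hX : Integrable X P) (hX0 : ∀ ω, 0 ≤ X ω) {C s : ℝ}
    (hs : 0 < s) (h : ∫ ω, X ω ∂P ≤ C * s ^ 2) :
    ∫⁻ ω, ENNReal.ofReal √(X ω) ∂P ≤ ENNReal.ofReal ((C + 1) / 2 * s) := by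
  have hY : Integrable (fun ω => (X ω / s + s) / 2) P :=
    ((hX.div_const s).add (integrable_const s)).div_const 2
  calc ∫⁻ ω, ENNReal.ofReal √(X ω) ∂P
      ≤ ∫⁻ ω, ENNReal.ofReal ((X ω / s + s) / 2) ∂P := by
        refine lintegral_mono fun ω => ENNReal.ofReal_le_ofReal ?_
        have h1 : X ω = √(X ω) ^ 2 := (Real.sq_sqrt (hX0 ω)).symm
        have h2 : (X ω / s + s) / 2 - √(X ω) = (√(X ω) - s) ^ 2 / (2 * s) := by
          rw [h1, Real.sqrt_sq (Real.sqrt_nonneg _)]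
          field_simp
          ring
        have h3 : 0 ≤ (√(X ω) - s) ^ 2 / (2 * s) := by positivity
        linarith
    _ = ENNReal.ofReal (∫ ω, (X ω / s + s) / 2 ∂P) := by
        refine (ofReal_integral_eq_lintegral_ofReal hY
          (Filter.Eventually.of_forall fun ω => ?_)).symm
        have := hX0 ω
        simp only [Pi.zero_apply]
        positivity
    _ ≤ ENNReal.ofReal ((C + 1) / 2 * s) := by
        refine ENNReal.ofReal_le_ofReal ?_
        rw [integral_div, integral_add (hX.div_const s) (integrable_const s), integral_div,
          integral_const]
        have h1 : (∫ ω, X ω ∂P) / s ≤ C * s := by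
          rw [div_le_iff₀ hs]
          linarith
        simp only [probReal_univ, smul_eq_mul, one_mul]
        linarith

namespace Slab

variable {M : Slab}

/-- Lipschitz boundary data on the two halves of the velocity space extend to boundary values that
are measurable on the whole line. -/
lemma exists_inflow {ψL ψR : ℝ → ℝ} (hψL : ∃ K : ℝ≥0, LipschitzOnWith K ψL (Set.Ioc M.δ 1))
    (hψR : ∃ K : ℝ≥0, LipschitzOnWith K ψR (Set.Ico (-1) (-M.δ))) :
    ∃ g : M.Inflow, ∀ μ ∈ M.S, g.val μ = inflowData ψL ψR μ := by
  obtain ⟨KL, hL⟩ := hψL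
  obtain ⟨KR, hR⟩ := hψR
  obtain ⟨gL, hgL, hL'⟩ := hL.extend_real
  obtain ⟨gR, hgR, hR'⟩ := hR.extend_real
  have hδ := M.δ_pos
  have hbd : ∀ {K : ℝ≥0} {h : ℝ → ℝ}, LipschitzWith K h → ∀ μ ∈ M.S, |h μ| ≤ |h 0| + K := by
    intro K h hh μ hμ
    have h1 := hh.dist_le_mul μ 0
    rw [Real.dist_eq, Real.dist_eq, sub_zero] at h1
    have h2 := abs_sub_abs_le_abs_sub (h μ) (h 0)
    have h3 := mul_le_mul_of_nonneg_left (M.mem_S_iff.mp hμ).2 K.coe_nonneg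
    linarith
  refine ⟨⟨fun μ => if 0 < μ then gL μ else gR μ,
    Measurable.ite measurableSet_Ioi hgL.continuous.measurable hgR.continuous.measurable,
    (|gL 0| + KL) + (|gR 0| + KR), KL + KR, by positivity, by positivity, ?_, ?_⟩, ?_⟩
  · intro μ hμ
    have h1 := hbd hgL μ hμ
    have h2 := hbd hgR μ hμ
    have h3 : 0 ≤ |gL 0| + KL := by positivity
    have h4 : 0 ≤ |gR 0| + KR := by positivity
    split_ifs <;> linarith
  · intro μ hμ μ' hμ' hs
    have h1 := hgL.dist_le_mul μ μ'
    have h2 := hgR.dist_le_mul μ μ'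
    rw [Real.dist_eq, Real.dist_eq] at h1 h2
    have h3 : 0 ≤ (KL : ℝ) * |μ - μ'| := by positivity
    have h4 : 0 ≤ (KR : ℝ) * |μ - μ'| := by positivity
    rcases pos_and_pos_or_neg_and_neg_of_mul_pos hs with ⟨h5, h6⟩ | ⟨h5, h6⟩
    · simp only [if_pos h5, if_pos h6]
      linarith
    · simp only [if_neg h5.not_gt, if_neg h6.not_gt]
      linarith
  · intro μ hμ
    simp only [inflowData]
    rcases hμ with h | h
    · have : ¬ 0 < μ := by linarith [h.2]
      rw [if_neg this, if_neg this, hR' h]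
    · have : 0 < μ := by linarith [h.1]
      rw [if_pos this, if_pos this, hL' h]

lemma integrable_div_σT {q : ℝ → ℝ} (hq : MemLp q 2 (volume.restrict (Set.Icc M.xL M.xR))) :
    Integrable (fun x => q x / M.σT x) M.ν := by
  rw [integrable_ν_iff]
  have h1 : IntegrableOn q M.I := hq.integrable one_le_two
  refine h1.congr_fun (fun x hx => ?_) M.measurableSet_I
  have := (M.σT_pos hx).ne'
  field_simp

lemma ae_scattering_ratio {σS : ℝ → ℝ} {lam : ℝ} (h0 : ∀ x ∈ Set.Icc M.xL M.xR, 0 ≤ σS x)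
    (h : eLpNorm (fun x => σS x / M.σT x) ∞ (volume.restrict (Set.Icc M.xL M.xR)) =
      ENNReal.ofReal lam) (hlam : 0 < lam) :
    ∀ᵐ y ∂M.ν, 0 ≤ σS y / M.σT y ∧ σS y / M.σT y ≤ lam := by
  have h1 : ∀ᵐ y ∂M.ν, ‖σS y / M.σT y‖ₑ ≤ ENNReal.ofReal lam := by
    rw [← h, eLpNorm_exponent_top]
    exact M.ν_absolutelyContinuous.ae_le (ae_le_eLpNormEssSup (f := fun x => σS x / M.σT x))
  filter_upwards [h1, M.ae_ν_mem] with y hy hyI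
  refine ⟨div_nonneg (h0 y hyI) (M.σT_pos hyI).le, ?_⟩
  rw [← ofReal_norm, ENNReal.ofReal_le_ofReal_iff hlam.le] at hy
  exact (le_abs_self _).trans hy

lemma memLp_of_eq_on {f f' : ℝ → ℝ} {N : ℝ} (hm : Measurable f) (hN : ∀ x, |f x| ≤ N)
    (h : ∀ x ∈ M.I, f' x = f x) : MemLp f' 2 M.ν := by
  have h1 : MemLp f 2 M.ν :=
    MemLp.of_bound hm.aestronglyMeasurable N (Filter.Eventually.of_forall hN)
  refine h1.ae_eq ?_
  filter_upwards [M.ae_ν_mem] with x hx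
  exact (h x hx).symm

lemma eLpNorm_congr_on {f f' : ℝ → ℝ} (h : ∀ x ∈ M.I, f x = f' x) :
    eLpNorm f 2 M.ν = eLpNorm f' 2 M.ν := by
  refine eLpNorm_congr_ae ?_
  filter_upwards [M.ae_ν_mem] with x hx
  exact h x hx

/-- The constant of the two error estimates. -/
def errorConst (g : M.Inflow) (Q : ℝ → ℝ) (lam₀ A : ℝ) : ℝ :=
  (mseConst g Q lam₀ A + 1) / 2 + (M.ν.real Set.univ) ^ (1 / 2 : ℝ) * biasConst g Q lam₀ A

lemma mseConst_nonneg (g : M.Inflow) (Q : ℝ → ℝ) (lam₀ A : ℝ) : 0 ≤ mseConst g Q lam₀ A := by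
  have : 0 ≤ M.ν.real Set.univ := measureReal_nonneg
  unfold mseConst
  positivity

lemma biasConst_nonneg (g : M.Inflow) (Q : ℝ → ℝ) {lam₀ : ℝ} (h : lam₀ < 1) (A : ℝ) :
    0 ≤ biasConst g Q lam₀ A := by
  have h1 : 0 ≤ M.ν.real Set.univ := measureReal_nonneg
  have h2 := mseConst_nonneg g Q lam₀ A
  have h3 : 0 ≤ 1 - lam₀ := by linarith
  unfold biasConst
  positivity

end Slab
end SlabROM

open SlabROM SlabROM.Slab in
theorem theorem4p1
    (xL xR : ℝ) (hx : xL < xR)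
    (σT : ℝ → ℝ) (hσT : Measurable σT)
    (hσT_bd : ∃ a b : ℝ, 0 < a ∧ ∀ x ∈ Set.Icc xL xR, a ≤ σT x ∧ σT x ≤ b)
    (q : ℝ → ℝ) (hq : MemLp q 2 (volume.restrict (Set.Icc xL xR)))
    (δ : ℝ) (hδ0 : 0 < δ) (hδ1 : δ < 1)
    (ψL ψR : ℝ → ℝ)
    (hψL : ∃ K : ℝ≥0, LipschitzOnWith K ψL (Set.Ioc δ 1))
    (hψR : ∃ K : ℝ≥0, LipschitzOnWith K ψR (Set.Ico (-1) (-δ)))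
    (A lam₀ : ℝ) (hlam₀ : lam₀ < 1) :
    ∃ C n₀ : ℝ, 0 < n₀ ∧
      ∀ (σS : ℝ → ℝ) (lam : ℝ), Measurable σS → (∀ x ∈ Set.Icc xL xR, 0 ≤ σS x) →
        eLpNorm (fun x => σS x / σT x) ∞ (volume.restrict (Set.Icc xL xR)) = ENNReal.ofReal lam →
        0 < lam → lam ≤ lam₀ →
      (∃ ψ : ℝ → ℝ → ℝ, SlabROM.SolvesRTE xL xR σT σS q ψL ψR δ ψ) ∧
      ∀ ψ : ℝ → ℝ → ℝ, SlabROM.SolvesRTE xL xR σT σS q ψL ψR δ ψ →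
      MemLp (SlabROM.avgDensity δ ψ) 2 (SlabROM.weightedMeasure xL xR σT) ∧
      ∀ (n m : ℕ), n = m + m → n₀ < (n : ℝ) →
      ∀ t : Fin (m + 1) → ℝ, SlabROM.IsPartition δ t →
        (∀ l, SlabROM.rescaledWeight δ t l ≤ A) →
      ∀ (Ω : Type*) [MeasurableSpace Ω] (P : Measure Ω) [IsProbabilityMeasure P]
        (U : Fin m → Ω → ℝ), (∀ l, Measurable (U l)) → iIndepFun U P →
        (∀ l, pdf.IsUniform (U l) (SlabROM.halfCell t l) P volume) →
      (∃ Ψ : Ω → Fin (m + m) → ℝ → ℝ,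
        ∀ᵐ ω ∂P, SlabROM.SolvesROM xL xR σT σS q ψL ψR δ t (fun l => U l ω) (Ψ ω)) ∧
      ∀ Ψ : Ω → Fin (m + m) → ℝ → ℝ,
        (∀ᵐ ω ∂P, SlabROM.SolvesROM xL xR σT σS q ψL ψR δ t (fun l => U l ω) (Ψ ω)) →
        -- the random density is square integrable almost surely and has an expectation
        (∀ᵐ ω ∂P, MemLp (SlabROM.discreteDensity δ t (Ψ ω)) 2
          (SlabROM.weightedMeasure xL xR σT)) ∧
        (∀ x ∈ Set.Icc xL xR, Integrable (fun ω => SlabROM.discreteDensity δ t (Ψ ω) x) P) ∧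
        MemLp (fun x => ∫ ω, SlabROM.discreteDensity δ t (Ψ ω) x ∂P) 2
          (SlabROM.weightedMeasure xL xR σT) ∧
        -- the expected single-run error
        AEMeasurable (fun ω => eLpNorm
          (fun x => SlabROM.discreteDensity δ t (Ψ ω) x - SlabROM.avgDensity δ ψ x) 2
          (SlabROM.weightedMeasure xL xR σT)) P ∧
        ∫⁻ ω, eLpNorm
          (fun x => SlabROM.discreteDensity δ t (Ψ ω) x - SlabROM.avgDensity δ ψ x) 2
          (SlabROM.weightedMeasure xL xR σT) ∂P
          ≤ ENNReal.ofReal (C * (n : ℝ) ^ (-(3 / 2) : ℝ) * Real.log n ^ (1 / 2 : ℝ)) ∧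
        -- the bias
        eLpNorm (fun x => (∫ ω, SlabROM.discreteDensity δ t (Ψ ω) x ∂P)
            - SlabROM.avgDensity δ ψ x) 2 (SlabROM.weightedMeasure xL xR σT)
          ≤ ENNReal.ofReal (C * lam * (n : ℝ) ^ (-3 : ℝ) * Real.log n) := by
  obtain ⟨a, b, ha, hab⟩ := hσT_bd
  obtain ⟨M, rfl, rfl, rfl, rfl⟩ : ∃ M : Slab, M.xL = xL ∧ M.xR = xR ∧ M.σT = σT ∧ M.δ = δ :=
    ⟨⟨xL, xR, hx, σT, hσT, a, b, ha, hab, δ, hδ0, hδ1⟩, rfl, rfl, rfl, rfl⟩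
  obtain ⟨g, hg⟩ := exists_inflow hψL hψR
  set Q : ℝ → ℝ := fun x => q x / M.σT x with hQ_def
  have hQ : Integrable Q M.ν := integrable_div_σT hq
  -- from `n > 3` on, `log n` is at least one
  refine ⟨errorConst g Q lam₀ A, 3, by norm_num, fun σS lam hσS hσS0 hlamS hlam hlamle => ?_⟩
  set c : ℝ → ℝ := fun x => σS x / M.σT x with hc_def
  have hcm : Measurable c := hσS.div M.meas
  have hcl : ∀ᵐ y ∂M.ν, 0 ≤ c y ∧ c y ≤ lam := ae_scattering_ratio hσS0 hlamS hlam
  have hc : ∀ᵐ y ∂M.ν, 0 ≤ c y ∧ c y ≤ lam₀ := by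
    filter_upwards [hcl] with y hy using ⟨hy.1, hy.2.trans hlamle⟩
  have hlam0 : 0 < lam₀ := hlam.trans_le hlamle
  -- the density of the truncated transport equation
  obtain ⟨φ, hφm, hφB, hφ⟩ : ∃ φ : ℝ → ℝ, Measurable φ ∧ (∀ x, |φ x| ≤ densityBound g Q lam₀) ∧
      ∀ x, φ x = ∫ μ, ang g (fun y => c y * φ y + Q y) μ x ∂M.unifS := by
    have h1 : Measurable fun x => ∫ μ, ang g Q μ x ∂M.unifS :=
      ((measurable_ang g hQ).comp
        measurable_swap).stronglyMeasurable.integral_prod_right'.measurable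
    have h2 : Measurable fun z : (Unit × ℝ) × ℝ => M.avgG M.unifS z.1.2 z.2 :=
      (measurable_avgG M.unifS).comp (measurable_fst.snd.prodMk measurable_snd)
    obtain ⟨Φ, h3, h4, h5⟩ := exists_density g (fun _ : Unit => M.unifS) h2
      (h1.comp measurable_snd) hcm hc hlam0.le hlam₀ hQ
    exact ⟨Φ (), h3.of_uncurry_left, h4 (), h5 ()⟩
  have hφI := integrable_mul_add hcm hc hQ hφm hφB
  refine ⟨⟨_, solvesRTE_ang g hg hφI.2 hφ⟩, fun ψ hψ => ?_⟩
  have hψφ : ∀ x ∈ M.I, avgDensity M.δ ψ x = φ x := by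
    have h1 := avgDensity_eq g hg hψ
    exact density_unique g M.unifS hcm hc hlam0.le hlam₀ hQ hφm hφB (fun x _ => hφ x) h1.1 h1.2
  refine ⟨memLp_of_eq_on hφm hφB hψφ, ?_⟩
  rintro n m rfl hn3 t ht hA Ω _ P _ U hUm hind hU
  have hm : 0 < m := by
    rcases Nat.eq_zero_or_pos m with h | h
    · subst h
      norm_num at hn3
    · exact h
  -- the density of the discrete system, as a function of the ordinates
  obtain ⟨Φ, hΦm, hΦB, hΦ⟩ : ∃ Φ : (Fin m → ℝ) → ℝ → ℝ, Measurable (Function.uncurry Φ) ∧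
      (∀ u x, |Φ u x| ≤ densityBound g Q lam₀) ∧
      ∀ u x, Φ u x = ∫ μ, ang g (fun y => c y * Φ u y + Q y) μ x ∂(ordinateMeasure M.δ t u) := by
    have hp := ht.isProbabilityMeasure_ordinateMeasure hδ0 hδ1
    exact exists_density g (ordinateMeasure M.δ t) (measurable_avgG_ordinateMeasure ht)
      (measurable_integral_ang_ordinateMeasure g ht hQ) hcm hc hlam0.le hlam₀ hQ
  have hmem := ae_mem_halfCell hUm hU
  have hΦI : ∀ u, Integrable (fun y => c y * Φ u y + Q y) M.ν := fun u =>
    (integrable_mul_add hcm hc hQ (hΦm.of_uncurry_left (x := u)) (hΦB u)).2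
  refine ⟨⟨fun ω l x => ang g (fun y => c y * Φ (fun l => U l ω) y + Q y)
    (symOrdinate (fun l => U l ω) l) x, ?_⟩, fun Ψ hΨ => ?_⟩
  · filter_upwards [hmem] with ω hω
    exact solvesROM_ang g ht hg hω (hΦI _) (hΦ _)
  have hΨΦ : ∀ᵐ ω ∂P, ∀ x ∈ M.I, discreteDensity M.δ t (Ψ ω) x = Φ (fun l => U l ω) x := by
    filter_upwards [hmem, hΨ] with ω hω hs
    have := ht.isProbabilityMeasure_ordinateMeasure hδ0 hδ1 (fun l => U l ω)
    have h1 := discreteDensity_eq g ht hm hg hω hs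
    exact density_unique g _ hcm hc hlam0.le hlam₀ hQ (hΦm.of_uncurry_left) (hΦB _)
      (fun x _ => hΦ _ x) h1.1 h1.2
  have hUz : Measurable fun z : Ω × ℝ => ((fun l => U l z.1 : Fin m → ℝ), z.2) :=
    (measurable_pi_lambda _ fun l => (hUm l).comp measurable_fst).prodMk measurable_snd
  have hΦU : Measurable fun z : Ω × ℝ => Φ (fun l => U l z.1) z.2 := by
    have h1 := hΦm.comp hUz
    exact h1
  have hΦUI : ∀ x, Integrable (fun ω => Φ (fun l => U l ω) x) P := fun x =>
    integrable_of_abs_le (hΦU.comp (measurable_id.prodMk measurable_const)).aestronglyMeasurable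
      fun ω => hΦB _ x
  have hmean : ∀ x ∈ M.I, ∫ ω, discreteDensity M.δ t (Ψ ω) x ∂P =
      ∫ ω, Φ (fun l => U l ω) x ∂P := fun x hx =>
    integral_congr_ae (by filter_upwards [hΨΦ] with ω hω using hω x hx)
  have hnorm : ∀ᵐ ω ∂P, eLpNorm
      (fun x => discreteDensity M.δ t (Ψ ω) x - avgDensity M.δ ψ x) 2 M.ν =
        ENNReal.ofReal √(∫ x, (Φ (fun l => U l ω) x - φ x) ^ 2 ∂M.ν) := by
    filter_upwards [hΨΦ] with ω hω
    have h1 : ∀ x ∈ M.I, discreteDensity M.δ t (Ψ ω) x - avgDensity M.δ ψ x =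
        Φ (fun l => U l ω) x - φ x := fun x hx => by rw [hω x hx, hψφ x hx]
    rw [eLpNorm_congr_on h1, eLpNorm_two_eq_ofReal_sqrt]
    exact memLp_of_eq_on ((hΦm.of_uncurry_left).sub hφm) (abs_error_le g hφB hΦB _) fun x _ => rfl
  have hsq := integrable_error_sq (P := P) g hφm hφB hΦm hΦB hUm
  have hn0 : (0 : ℝ) < ((m + m : ℕ) : ℝ) := by linarith
  have hlog : 1 ≤ Real.log ((m + m : ℕ) : ℝ) := by
    rw [Real.le_log_iff_exp_le hn0]
    linarith [Real.exp_one_lt_d9]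
  have hpow3 : ((m + m : ℕ) : ℝ) ^ (-3 : ℝ) = (((m + m : ℕ) : ℝ) ^ 3)⁻¹ := by
    rw [Real.rpow_neg hn0.le]
    norm_cast
  have hmse0 := mseConst_nonneg g Q lam₀ A
  have hbias0 := biasConst_nonneg g Q hlam₀ A
  refine ⟨?_, fun x hx => ?_, ?_, ?_, ?_, ?_⟩
  · filter_upwards [hΨΦ] with ω hω
    exact memLp_of_eq_on (hΦm.of_uncurry_left) (hΦB _) hω
  · refine (hΦUI x).congr ?_
    filter_upwards [hΨΦ] with ω hω using (hω x hx).symm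
  · refine memLp_of_eq_on (N := densityBound g Q lam₀) ?_ (fun x => ?_) hmean
    · exact (hΦU.comp measurable_swap).stronglyMeasurable.integral_prod_right'.measurable
    · have h1 := norm_integral_le_of_norm_le (f := fun ω => Φ (fun l => U l ω) x)
        (integrable_const (μ := P) (densityBound g Q lam₀))
        (Filter.Eventually.of_forall fun ω => hΦB _ x)
      simpa using h1
  · refine AEMeasurable.congr ?_ (Filter.EventuallyEq.symm hnorm)
    exact (hsq.integral_prod_left.1.aemeasurable.sqrt).ennreal_ofReal
  · refine (lintegral_congr_ae hnorm).trans_le ?_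
    have hs : 0 < ((m + m : ℕ) : ℝ) ^ (-(3 / 2) : ℝ) := Real.rpow_pos_of_pos hn0 _
    have hs2 : (((m + m : ℕ) : ℝ) ^ (-(3 / 2) : ℝ)) ^ 2 = (((m + m : ℕ) : ℝ) ^ 3)⁻¹ := by
      rw [← hpow3, ← Real.rpow_natCast, ← Real.rpow_mul hn0.le]
      norm_num
    have h1 := integral_integral_error_sq_le g hcm hc hlam0 hlam₀ hQ hφm hφB hφ ht hΦm hΦB hΦ hm hA
      hUm hind hU
    rw [div_eq_mul_inv, ← hs2] at h1
    refine (lintegral_ofReal_sqrt_le hsq.integral_prod_left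
      (fun ω => integral_nonneg fun x => sq_nonneg _) hs h1).trans (ENNReal.ofReal_le_ofReal ?_)
    have h2 : 1 ≤ Real.log ((m + m : ℕ) : ℝ) ^ (1 / 2 : ℝ) := Real.one_le_rpow hlog (by norm_num)
    have h3 : (mseConst g Q lam₀ A + 1) / 2 ≤ errorConst g Q lam₀ A := by
      unfold errorConst
      have : 0 ≤ (M.ν.real Set.univ) ^ (1 / 2 : ℝ) * biasConst g Q lam₀ A := by positivity
      linarith
    have h4 : 0 ≤ errorConst g Q lam₀ A := le_trans (by positivity) h3
    calc (mseConst g Q lam₀ A + 1) / 2 * ((m + m : ℕ) : ℝ) ^ (-(3 / 2) : ℝ)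
        ≤ errorConst g Q lam₀ A * ((m + m : ℕ) : ℝ) ^ (-(3 / 2) : ℝ) * 1 := by
          rw [mul_one]
          gcongr
      _ ≤ _ := by gcongr
  · have h1 : ∀ᵐ x ∂M.ν, ‖(∫ ω, discreteDensity M.δ t (Ψ ω) x ∂P) - avgDensity M.δ ψ x‖ ≤
        lam * biasConst g Q lam₀ A / ((m + m : ℕ) : ℝ) ^ 3 := by
      filter_upwards [M.ae_ν_mem] with x hx
      have h2 := abs_integral_error_le g hcm hc hlam0 hlam₀ hQ hφm hφB hφ ht hΦm hΦB hΦ hm hA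
        hUm hind hU hlam.le (by filter_upwards [hcl] with y hy using hy.2) x
      rw [integral_sub (hΦUI x) (integrable_const _), integral_const, probReal_univ, one_smul] at h2
      rw [hmean x hx, hψφ x hx]
      exact h2
    refine (eLpNorm_le_of_ae_bound h1).trans ?_
    have h2 : M.ν Set.univ = ENNReal.ofReal (M.ν.real Set.univ) :=
      (ENNReal.ofReal_toReal (measure_ne_top _ _)).symm
    have h3 : 0 ≤ M.ν.real Set.univ := measureReal_nonneg
    rw [h2, ENNReal.ofReal_rpow_of_nonneg h3 (by norm_num), ← ENNReal.ofReal_mul (by positivity)]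
    refine ENNReal.ofReal_le_ofReal ?_
    have h4 : (M.ν.real Set.univ) ^ (1 / 2 : ℝ) * biasConst g Q lam₀ A ≤ errorConst g Q lam₀ A := by
      unfold errorConst
      have : 0 ≤ (mseConst g Q lam₀ A + 1) / 2 := by positivity
      linarith
    have h5 : 0 ≤ errorConst g Q lam₀ A := le_trans (by positivity) h4
    rw [hpow3]
    calc (M.ν.real Set.univ) ^ ((2 : ℝ≥0∞).toReal⁻¹) *
          (lam * biasConst g Q lam₀ A / ((m + m : ℕ) : ℝ) ^ 3)
        = (M.ν.real Set.univ) ^ (1 / 2 : ℝ) * biasConst g Q lam₀ A * lam *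
          (((m + m : ℕ) : ℝ) ^ 3)⁻¹ := by
          norm_num
          ring
      _ ≤ errorConst g Q lam₀ A * lam * (((m + m : ℕ) : ℝ) ^ 3)⁻¹ * 1 := by
          rw [mul_one]
          gcongr
      _ ≤ _ := by gcongr

end
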